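/- Let $\mathcal H$ be the Hilbert space of the one-mode harmonic oscillator, i.e. a complex Hilbert space with a fixed orthonormal (Fock) basis $\{|n\rangle\}_{n\in\mathbb N}$. A quantum operation is a linear completely positive map on the trace-class operators on $\mathcal H$ that is continuous in the trace norm $\|X\|_1=\mathrm{Tr}\sqrt{X^\dagger X}$. If $\Phi$ is a linear, trace-norm continuous map on trace-class operators, its Hilbert–Schmidt dual $\Phi^\dagger$ is the (unique) operator-norm continuous linear map on bounded operators with $\mathrm{Tr}[Y\,\Phi(X)]=\mathrm{Tr}[\Phi^\dagger(Y)\,X]$ for every trace-class $X$ and every bounded $Y$. For a positive trace-class operator $X$ with eigenvalues $x_0\ge x_1\ge\dots$ (counted with multiplicity), its Fock rearrangement is $X^\downarrow=\sum_{n=0}^\infty x_n|n\rangle\langle n|$, and $X$ is passive if $X=X^\downarrow$. For positive trace-class $X,Y$ with eigenvalues $x_0\ge x_1\ge\dots$ and $y_0\ge y_1\ge\dots$, write $Y\prec_w X$ if $\sum_{i=0}^n y_i\le\sum_{i=0}^n x_i$ for all $n\in\mathbb N$. A map $\Phi$ on trace-class operators is passive-preserving if $\Phi(X)$ is passive for every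 passive positive trace-class $X$, and Fock-optimal if $\Phi(X)\prec_w\Phi(X^\downarrow)$ for every positive trace-class $X$. Theorem. Let $\Phi$ be a quantum operation such that its Hilbert–Schmidt dual $\Phi^\dagger$ maps trace-class operators to trace-class operators and the restriction of $\Phi^\dagger$ to trace-class operators is continuous in the trace norm. Then $\Phi$ is passive-preserving and Fock-optimal if and only if the restriction of $\Phi^\dagger$ to trace-class operators is passive-preserving and Fock-optimal. -/

import Mathlib

noncomputable section
set_option linter.unusedSectionVars false
namespace FockRearrangement

open scoped ENNReal InnerProductSpace ComplexOrder

/- Throughout, `H` is the Hilbert space of the harmonic oscillator, given with its Fock basis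
`e 0, e 1, e 2, …` (`e n` is the `n`-th Fock state), and operators are bounded operators on `H`. -/

variable {H : Type*} [NormedAddCommGroup H] [InnerProductSpace ℂ H] [CompleteSpace H]

/-- The trace norm `‖X‖₁ = Tr √(X†X)`. -/
def traceNorm (e : HilbertBasis ℕ ℂ H) (X : H →L[ℂ] H) : ℝ≥0∞ :=
  ∑' n, ENNReal.ofReal (⟪e n, CFC.abs X (e n)⟫_ℂ).re

/-- The trace. -/
def trace (e : HilbertBasis ℕ ℂ H) (X : H →L[ℂ] H) : ℂ := ∑' n, ⟪e n, X (e n)⟫_ℂ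

/-- The square `‖A‖₂²` of the Hilbert–Schmidt norm. -/
def hsq (e : HilbertBasis ℕ ℂ H) (A : H →L[ℂ] H) : ℝ≥0∞ := ∑' n, ‖A (e n)‖ₑ ^ 2

/-- The sum of the absolute values of the diagonal matrix elements of `X`. -/
def diagSum (e : HilbertBasis ℕ ℂ H) (X : H →L[ℂ] H) : ℝ≥0∞ := ∑' n, ‖⟪e n, X (e n)⟫_ℂ‖ₑ

lemma tsum_enorm_inner_sq (e : HilbertBasis ℕ ℂ H) (v : H) :
    ∑' n, ‖⟪e n, v⟫_ℂ‖ₑ ^ 2 = ‖v‖ₑ ^ 2 := by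
  have h : HasSum (fun n => ‖⟪e n, v⟫_ℂ‖ ^ 2) (‖v‖ ^ 2) := by
    have h1 := (e.hasSum_inner_mul_inner v v).mapL Complex.reCLM
    convert h1 using 1
    · funext n
      rw [← inner_conj_symm v (e n), Complex.reCLM_apply, mul_comm, Complex.mul_conj,
        Complex.normSq_eq_norm_sq, Complex.ofReal_re]
    · rw [inner_self_eq_norm_sq_to_K]; norm_cast
  have h2 : ∀ w : ℝ, 0 ≤ w → ENNReal.ofReal w ^ 2 = ENNReal.ofReal (w ^ 2) := fun w hw =>
    (ENNReal.ofReal_pow hw 2).symm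
  simp only [← ofReal_norm, h2 _ (norm_nonneg _)]
  rw [← h.tsum_eq, ENNReal.ofReal_tsum_of_nonneg (fun n => by positivity) h.summable]

lemma hsq_star (e : HilbertBasis ℕ ℂ H) (A : H →L[ℂ] H) : hsq e (star A) = hsq e A := by
  unfold hsq
  simp only [← tsum_enorm_inner_sq e]
  rw [ENNReal.tsum_comm]
  refine tsum_congr fun n => tsum_congr fun m => ?_
  rw [ContinuousLinearMap.star_eq_adjoint, ContinuousLinearMap.adjoint_inner_right,
    ← inner_conj_symm, ← ofReal_norm, RCLike.norm_conj, ofReal_norm]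

lemma hsq_mul_le (e : HilbertBasis ℕ ℂ H) (C A : H →L[ℂ] H) (hC : ‖C‖ ≤ 1) :
    hsq e (C * A) ≤ hsq e A := by
  refine ENNReal.tsum_le_tsum fun n => ?_
  gcongr
  rw [← ofReal_norm, ← ofReal_norm]
  apply ENNReal.ofReal_le_ofReal
  exact (C.le_opNorm _).trans (mul_le_of_le_one_left (norm_nonneg _) hC)

lemma hsq_mul_le' (e : HilbertBasis ℕ ℂ H) (A C : H →L[ℂ] H) (hC : ‖C‖ ≤ 1) :
    hsq e (A * C) ≤ hsq e A := by
  rw [← hsq_star, star_mul, ← hsq_star e A]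
  exact hsq_mul_le e _ _ (by rwa [norm_star])

lemma diagSum_star_mul_le (e : HilbertBasis ℕ ℂ H) (A B : H →L[ℂ] H) :
    2 * diagSum e (star A * B) ≤ hsq e A + hsq e B := by
  unfold diagSum hsq
  rw [← ENNReal.tsum_mul_left, ← ENNReal.tsum_add]
  refine ENNReal.tsum_le_tsum fun n => ?_
  rw [mul_apply_eq_comp, ContinuousLinearMap.star_eq_adjoint,
    ContinuousLinearMap.adjoint_inner_right]
  have h : 2 * ‖⟪A (e n), B (e n)⟫_ℂ‖ ≤ ‖A (e n)‖ ^ 2 + ‖B (e n)‖ ^ 2 := by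
    nlinarith [norm_inner_le_norm (𝕜 := ℂ) (A (e n)) (B (e n)),
      sq_nonneg (‖A (e n)‖ - ‖B (e n)‖)]
  have := ENNReal.ofReal_le_ofReal h
  rwa [ENNReal.ofReal_mul (by norm_num), ENNReal.ofReal_add (by positivity) (by positivity),
    ENNReal.ofReal_pow (by positivity), ENNReal.ofReal_pow (by positivity), ofReal_norm,
    ofReal_norm, ofReal_norm, ENNReal.ofReal_ofNat] at this

lemma norm_abs_apply (X : H →L[ℂ] H) (x y : H) :
    ⟪CFC.abs X x, CFC.abs X y⟫_ℂ = ⟪X x, X y⟫_ℂ := by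
  have h1 : star (CFC.abs X) = CFC.abs X := (CFC.abs_nonneg X).isSelfAdjoint
  rw [← ContinuousLinearMap.adjoint_inner_right, ← ContinuousLinearMap.star_eq_adjoint, h1,
    ← mul_apply_eq_comp, CFC.abs_mul_abs, mul_apply_eq_comp,
    ContinuousLinearMap.star_eq_adjoint, ContinuousLinearMap.adjoint_inner_right]

/-- Polar decomposition. -/
lemma exists_polar (X : H →L[ℂ] H) :
    ∃ U : H →L[ℂ] H, ‖U‖ ≤ 1 ∧ X = U * CFC.abs X ∧ CFC.abs X = star U * X := by
  set A := CFC.abs X with hA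
  let K : Submodule ℂ H := (LinearMap.range A.toLinearMap).topologicalClosure
  have : CompleteSpace K := (Submodule.isClosed_topologicalClosure _).completeSpace_coe
  have hmem : ∀ x, A x ∈ K := fun x => Submodule.le_topologicalClosure _ ⟨x, rfl⟩
  let eA : H →ₗ[ℂ] K := A.toLinearMap.codRestrict K hmem
  have hdense : DenseRange eA := by
    intro k
    rw [Metric.mem_closure_iff]
    intro ε hε
    obtain ⟨_, ⟨x, rfl⟩, hx⟩ := Metric.mem_closure_iff.1 k.2 ε hε
    exact ⟨eA x, ⟨x, rfl⟩, hx⟩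
  have hin : ∀ x y, ⟪A x, A y⟫_ℂ = ⟪X x, X y⟫_ℂ := norm_abs_apply X
  have hnorm : ∀ x, ‖X.toLinearMap x‖ ≤ 1 * ‖eA x‖ := fun x => by
    rw [one_mul]
    change ‖X x‖ ≤ ‖A x‖
    rw [@norm_eq_sqrt_re_inner ℂ, @norm_eq_sqrt_re_inner ℂ _ _ _ _ (A x), hin]
  let U0 : K →L[ℂ] H := X.toLinearMap.extendOfNorm eA
  have hU0 : ∀ x, U0 ⟨A x, hmem x⟩ = X x := fun x =>
    LinearMap.extendOfNorm_eq hdense ⟨1, hnorm⟩ x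
  have hU0n : ‖U0‖ ≤ 1 := LinearMap.opNorm_extendOfNorm_le hdense zero_le_one hnorm
  let U : H →L[ℂ] H := U0 ∘L K.orthogonalProjectionOnto
  have hUA : ∀ x, U (A x) = X x := fun x => by
    rw [← hU0 x]
    change U0 (K.orthogonalProjectionOnto (A x)) = _
    congr 1
    exact Submodule.orthogonalProjectionOnto_mem_subspace_eq_self (⟨A x, hmem x⟩ : K)
  refine ⟨U, ?_, ?_, ?_⟩
  · refine (ContinuousLinearMap.opNorm_comp_le _ _).trans ?_
    exact mul_le_one₀ hU0n (norm_nonneg _) (Submodule.orthogonalProjectionOnto_norm_le K)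
  · ext x; exact (hUA x).symm
  · ext x
    rw [mul_apply_eq_comp, ContinuousLinearMap.star_eq_adjoint]
    have hK : ContinuousLinearMap.adjoint U (X x) ∈ K := by
      rw [ContinuousLinearMap.adjoint_comp, Submodule.adjoint_orthogonalProjectionOnto]
      exact Subtype.mem _
    have hd : A x - ContinuousLinearMap.adjoint U (X x) ∈ K := K.sub_mem (hmem x) hK
    have hperp : A x - ContinuousLinearMap.adjoint U (X x) ∈ Kᗮ := by
      rw [Submodule.orthogonal_closure, Submodule.mem_orthogonal]
      rintro _ ⟨y, rfl⟩
      change ⟪A y, _⟫_ℂ = 0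
      rw [inner_sub_right, ContinuousLinearMap.adjoint_inner_right, hUA, hin, sub_self]
    exact sub_eq_zero.1 ((Submodule.disjoint_def.1 (Submodule.orthogonal_disjoint K)) _ hd hperp)

lemma traceNorm_eq_diagSum (e : HilbertBasis ℕ ℂ H) (X : H →L[ℂ] H) :
    traceNorm e X = diagSum e (CFC.abs X) := by
  refine tsum_congr fun n => ?_
  have h := (ContinuousLinearMap.nonneg_iff_isPositive _).1 (CFC.abs_nonneg X)
  have h1 := h.inner_nonneg_right (e n)
  obtain ⟨h2, h3⟩ := Complex.nonneg_iff.1 h1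
  rw [← ofReal_norm, ← Complex.re_eq_norm.2 h1]

lemma exists_factor (e : HilbertBasis ℕ ℂ H) (X : H →L[ℂ] H) :
    ∃ V S : H →L[ℂ] H, X = V * S ∧ hsq e S = traceNorm e X ∧ hsq e V ≤ traceNorm e X := by
  obtain ⟨U, hU, hX, -⟩ := exists_polar X
  set S := CFC.sqrt (CFC.abs X)
  have hS : star S = S := (CFC.sqrt_nonneg _).isSelfAdjoint
  have hSS : S * S = CFC.abs X := CFC.sqrt_mul_sqrt_self _ (CFC.abs_nonneg X)
  have h1 : hsq e S = traceNorm e X := by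
    refine tsum_congr fun n => ?_
    rw [← hSS, mul_apply_eq_comp, ← ContinuousLinearMap.adjoint_inner_left,
      ← ContinuousLinearMap.star_eq_adjoint, hS, ← @inner_self_ofReal_re ℂ, inner_self_eq_norm_sq]
    change _ = ENNReal.ofReal ((‖S (e n)‖ ^ 2 : ℝ) : ℂ).re
    rw [Complex.ofReal_re, ENNReal.ofReal_pow (norm_nonneg _), ofReal_norm]
  refine ⟨U * S, S, ?_, h1, h1 ▸ hsq_mul_le e _ _ hU⟩
  rw [mul_assoc, hSS]; exact hX

lemma diagSum_mul_le (e : HilbertBasis ℕ ℂ H) (C X : H →L[ℂ] H) (hC : ‖C‖ ≤ 1) :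
    diagSum e (C * X) ≤ traceNorm e X := by
  obtain ⟨V, S, hX, hS, hV⟩ := exists_factor e X
  have h := diagSum_star_mul_le e (star (C * V)) S
  rw [star_star, hsq_star, mul_assoc, ← hX, hS] at h
  have h2 := h.trans (add_le_add_left ((hsq_mul_le e C V hC).trans hV) _)
  rw [← two_mul] at h2
  exact (ENNReal.mul_le_mul_iff_right (by simp) (by simp)).1 h2

lemma diagSum_add_le (e : HilbertBasis ℕ ℂ H) (X Y : H →L[ℂ] H) :
    diagSum e (X + Y) ≤ diagSum e X + diagSum e Y := by
  unfold diagSum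
  rw [← ENNReal.tsum_add]
  refine ENNReal.tsum_le_tsum fun n => ?_
  rw [add_apply, inner_add_right]
  exact enorm_add_le _ _

lemma traceNorm_add_le (e : HilbertBasis ℕ ℂ H) (X Y : H →L[ℂ] H) :
    traceNorm e (X + Y) ≤ traceNorm e X + traceNorm e Y := by
  obtain ⟨U, hU, -, hX⟩ := exists_polar (X + Y)
  rw [traceNorm_eq_diagSum, hX, mul_add]
  have hU' : ‖star U‖ ≤ 1 := by rwa [norm_star]
  exact (diagSum_add_le e _ _).trans
    (add_le_add (diagSum_mul_le e _ _ hU') (diagSum_mul_le e _ _ hU'))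

lemma traceNorm_smul (e : HilbertBasis ℕ ℂ H) (c : ℂ) (X : H →L[ℂ] H) :
    traceNorm e (c • X) = ‖c‖ₑ * traceNorm e X := by
  unfold traceNorm
  rw [CFC.abs_smul, ← ENNReal.tsum_mul_left]
  refine tsum_congr fun n => ?_
  rw [smul_apply, ← Complex.coe_smul, inner_smul_right, Complex.re_ofReal_mul,
    ENNReal.ofReal_mul (norm_nonneg _), ofReal_norm]

lemma traceNorm_star_mul_le (e : HilbertBasis ℕ ℂ H) (A B : H →L[ℂ] H) :
    2 * traceNorm e (star A * B) ≤ hsq e A + hsq e B := by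
  obtain ⟨U, hU, -, hX⟩ := exists_polar (star A * B)
  rw [traceNorm_eq_diagSum, hX, ← mul_assoc, ← star_mul]
  exact (diagSum_star_mul_le e _ _).trans (add_le_add_left (hsq_mul_le' e _ _ hU) _)

lemma hsq_rankOne (e : HilbertBasis ℕ ℂ H) (u v : H) (hu : ‖u‖ = 1) :
    hsq e (InnerProductSpace.rankOne ℂ u v) = ‖v‖ₑ ^ 2 := by
  unfold hsq
  rw [← tsum_enorm_inner_sq e]
  refine tsum_congr fun n => ?_
  rw [InnerProductSpace.rankOne_apply, enorm_smul, ← inner_conj_symm, ← ofReal_norm,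
    RCLike.norm_conj, ofReal_norm, ← ofReal_norm u, hu]
  simp

lemma traceNorm_rankOne_le (e : HilbertBasis ℕ ℂ H) (u v : H) :
    traceNorm e (InnerProductSpace.rankOne ℂ u v) ≤ ‖u‖ₑ * ‖v‖ₑ := by
  have key : ∀ u v : H, ‖u‖ = 1 → ‖v‖ = 1 →
      traceNorm e (InnerProductSpace.rankOne ℂ u v) ≤ 1 := by
    intro u v hu hv
    have h := traceNorm_star_mul_le e (InnerProductSpace.rankOne ℂ u u)
      (InnerProductSpace.rankOne ℂ u v)
    rw [hsq_rankOne e u u hu, hsq_rankOne e u v hu, ContinuousLinearMap.star_eq_adjoint,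
      InnerProductSpace.adjoint_rankOne, ContinuousLinearMap.mul_def,
      InnerProductSpace.rankOne_comp_rankOne, inner_self_eq_norm_sq_to_K, ← ofReal_norm,
      ← ofReal_norm, hu, hv] at h
    have h2 : (2 : ℝ≥0∞) * traceNorm e (InnerProductSpace.rankOne ℂ u v) ≤ 2 * 1 := by
      simpa [one_add_one_eq_two] using h
    exact (ENNReal.mul_le_mul_iff_right (by simp) (by simp)).1 h2
  by_cases hu : u = 0
  · subst hu
    have := traceNorm_smul e 0 0
    simp_all
  by_cases hv : v = 0
  · subst hv
    have := traceNorm_smul e 0 0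
    simp_all
  have h1 := key (((‖u‖⁻¹ : ℝ) : ℂ) • u) (((‖v‖⁻¹ : ℝ) : ℂ) • v)
    (by simp [norm_smul, hu]) (by simp [norm_smul, hv])
  have h2 : InnerProductSpace.rankOne ℂ u v = (((‖u‖ * ‖v‖ : ℝ)) : ℂ) •
      InnerProductSpace.rankOne ℂ (((‖u‖⁻¹ : ℝ) : ℂ) • u) (((‖v‖⁻¹ : ℝ) : ℂ) • v) := by
    have hu' : (‖u‖ : ℂ) ≠ 0 := by simpa using hu
    have hv' : (‖v‖ : ℂ) ≠ 0 := by simpa using hv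
    ext x
    simp [smul_smul]
    congr 1
    field_simp
  rw [h2, traceNorm_smul]
  have h3 : ‖(((‖u‖ * ‖v‖ : ℝ)) : ℂ)‖ₑ = ‖u‖ₑ * ‖v‖ₑ := by
    rw [← ofReal_norm, Complex.norm_real, norm_mul, norm_norm, norm_norm,
      ENNReal.ofReal_mul (norm_nonneg _), ofReal_norm, ofReal_norm]
  rw [h3]
  exact mul_le_of_le_one_right' h1

/-- The trace-class operators. -/
def traceClass (e : HilbertBasis ℕ ℂ H) : Submodule ℂ (H →L[ℂ] H) where
  carrier := {X | traceNorm e X < ∞}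
  add_mem' hX hY := (traceNorm_add_le e _ _).trans_lt (ENNReal.add_lt_top.2 ⟨hX, hY⟩)
  zero_mem' := by
    have := traceNorm_smul e 0 0
    simp_all
  smul_mem' c X hX := by
    change traceNorm e _ < ∞
    rw [traceNorm_smul]
    exact ENNReal.mul_lt_top enorm_lt_top hX



/-- The trace norm of a trace-class operator, as a real number. -/
def norm1 (e : HilbertBasis ℕ ℂ H) (X : traceClass e) : ℝ := (traceNorm e (X : H →L[ℂ] H)).toReal

/-- Continuity, in the trace norm, of a linear map on trace-class operators. -/
def TraceNormContinuous (e : HilbertBasis ℕ ℂ H) (Φ : traceClass e →ₗ[ℂ] traceClass e) : Prop :=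
  ∀ X : traceClass e, ∀ ε > 0, ∃ δ > 0, ∀ Y : traceClass e,
    norm1 e (Y - X) < δ → norm1 e (Φ Y - Φ X) < ε

/-- `D` is a Hilbert–Schmidt dual of `Φ`: `Tr[Y Φ(X)] = Tr[D(Y) X]` for every trace-class `X` and
every bounded `Y`. -/
def IsHSDual (e : HilbertBasis ℕ ℂ H) (Φ : traceClass e →ₗ[ℂ] traceClass e)
    (D : (H →L[ℂ] H) →L[ℂ] (H →L[ℂ] H)) : Prop :=
  ∀ (Y : H →L[ℂ] H) (X : traceClass e),
    trace e (Y * (Φ X : H →L[ℂ] H)) = trace e (D Y * (X : H →L[ℂ] H))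

lemma norm1_smul (e : HilbertBasis ℕ ℂ H) (c : ℂ) (X : traceClass e) :
    norm1 e (c • X) = ‖c‖ * norm1 e X := by
  unfold norm1
  rw [Submodule.coe_smul, traceNorm_smul, ENNReal.toReal_mul, toReal_enorm]

lemma norm1_nonneg (e : HilbertBasis ℕ ℂ H) (X : traceClass e) : 0 ≤ norm1 e X :=
  ENNReal.toReal_nonneg

lemma TraceNormContinuous.exists_bound {e : HilbertBasis ℕ ℂ H}
    {Φ : traceClass e →ₗ[ℂ] traceClass e} (h : TraceNormContinuous e Φ) :
    ∃ C : ℝ, 0 ≤ C ∧ ∀ X, norm1 e (Φ X) ≤ C * norm1 e X := by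
  obtain ⟨δ, hδ, h⟩ := h 0 1 one_pos
  refine ⟨δ⁻¹, by positivity, fun X => le_of_forall_gt_imp_ge_of_dense fun t ht => ?_⟩
  have ht0 : 0 < t := (mul_nonneg (by positivity) (norm1_nonneg e X)).trans_lt ht
  have hc : ‖((t⁻¹ : ℝ) : ℂ)‖ = t⁻¹ := by
    rw [Complex.norm_real, Real.norm_of_nonneg (by positivity)]
  have h1 := h (((t⁻¹ : ℝ) : ℂ) • X) (by
    rw [sub_zero, norm1_smul, hc]
    rw [inv_mul_lt_iff₀ hδ] at ht
    rw [inv_mul_lt_iff₀ ht0]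
    linarith)
  rw [map_zero, sub_zero, map_smul, norm1_smul, hc, inv_mul_lt_iff₀ ht0, mul_one] at h1
  exact h1.le

lemma diagSum_mul_le_norm (e : HilbertBasis ℕ ℂ H) (C X : H →L[ℂ] H) :
    diagSum e (C * X) ≤ ‖C‖ₑ * traceNorm e X := by
  by_cases hC : C = 0
  · subst hC; simp [diagSum]
  have hC' : (‖C‖ : ℂ) ≠ 0 := by simpa using hC
  have h1 := diagSum_mul_le e ((‖C‖ : ℂ)⁻¹ • C) X (by simp [norm_smul, hC])
  calc diagSum e (C * X) = ‖C‖ₑ * diagSum e (((‖C‖ : ℂ)⁻¹ • C) * X) := by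
        unfold diagSum
        rw [← ENNReal.tsum_mul_left]
        refine tsum_congr fun n => ?_
        have : ‖C‖ₑ = ‖(‖C‖ : ℂ)‖ₑ := by
          rw [← ofReal_norm, ← ofReal_norm, Complex.norm_real, norm_norm]
        rw [this, ← enorm_mul, ← inner_smul_right, smul_mul_assoc, smul_apply, smul_smul,
          mul_inv_cancel₀ hC', one_smul]
    _ ≤ _ := by gcongr

lemma summable_trace (e : HilbertBasis ℕ ℂ H) (Y : H →L[ℂ] H) (X : traceClass e) :
    Summable fun n => ⟪e n, (Y * (X : H →L[ℂ] H)) (e n)⟫_ℂ := by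
  have h : diagSum e (Y * (X : H →L[ℂ] H)) < ∞ :=
    (diagSum_mul_le_norm e Y X).trans_lt (ENNReal.mul_lt_top enorm_lt_top X.2)
  refine Summable.of_norm ?_
  have := ENNReal.summable_toReal h.ne
  simpa using this

lemma norm_trace_mul_le (e : HilbertBasis ℕ ℂ H) (Y : H →L[ℂ] H) (X : traceClass e) :
    ‖trace e (Y * (X : H →L[ℂ] H))‖ ≤ ‖Y‖ * norm1 e X := by
  have h := diagSum_mul_le_norm e Y X
  have h0 : ‖Y‖ₑ * traceNorm e (X : H →L[ℂ] H) < ∞ := ENNReal.mul_lt_top enorm_lt_top X.2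
  refine (norm_tsum_le_tsum_norm (summable_trace e Y X).norm).trans ?_
  have h1 := ENNReal.toReal_mono h0.ne h
  rw [ENNReal.toReal_mul, toReal_enorm] at h1
  refine le_trans (le_of_eq ?_) h1
  unfold diagSum
  rw [ENNReal.tsum_toReal_eq (fun n => enorm_ne_top)]
  simp

/-- The functional `X ↦ Tr[Y X]` on trace-class operators. -/
def traceMul (e : HilbertBasis ℕ ℂ H) : (H →L[ℂ] H) →ₗ[ℂ] traceClass e →ₗ[ℂ] ℂ :=
  LinearMap.mk₂ ℂ (fun Y X => trace e (Y * (X : H →L[ℂ] H)))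
    (fun Y Y' X => by
      unfold trace
      rw [← (summable_trace e Y X).tsum_add (summable_trace e Y' X)]
      simp only [add_mul, add_apply, inner_add_right])
    (fun c Y X => by
      unfold trace
      rw [smul_eq_mul, ← tsum_mul_left]
      simp only [smul_mul_assoc, smul_apply, inner_smul_right])
    (fun Y X X' => by
      unfold trace
      rw [← (summable_trace e Y X).tsum_add (summable_trace e Y X')]
      simp only [Submodule.coe_add, mul_add, add_apply, inner_add_right])
    (fun c Y X => by
      unfold trace
      rw [smul_eq_mul, ← tsum_mul_left]
      simp only [Submodule.coe_smul, mul_smul_comm, smul_apply, inner_smul_right])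

lemma trace_mul_rankOne (e : HilbertBasis ℕ ℂ H) (A : H →L[ℂ] H) (u v : H) :
    trace e (A * InnerProductSpace.rankOne ℂ u v) = ⟪v, A u⟫_ℂ := by
  rw [← e.tsum_inner_mul_inner]
  refine tsum_congr fun n => ?_
  rw [mul_apply_eq_comp, InnerProductSpace.rankOne_apply, map_smul, inner_smul_right]

/-- `|u⟩⟨v|` as a trace-class operator. -/
def ketbra (e : HilbertBasis ℕ ℂ H) (u v : H) : traceClass e :=
  ⟨InnerProductSpace.rankOne ℂ u v,
    (traceNorm_rankOne_le e u v).trans_lt (ENNReal.mul_lt_top enorm_lt_top enorm_lt_top)⟩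

lemma norm1_ketbra_le (e : HilbertBasis ℕ ℂ H) (u v : H) :
    norm1 e (ketbra e u v) ≤ ‖u‖ * ‖v‖ := by
  have h := ENNReal.toReal_mono (ENNReal.mul_lt_top enorm_lt_top enorm_lt_top).ne
    (traceNorm_rankOne_le e u v)
  rwa [ENNReal.toReal_mul, toReal_enorm, toReal_enorm] at h

/-- The projection onto the first `N` vectors of the basis. -/
def headProj (e : HilbertBasis ℕ ℂ H) (N : ℕ) : H →L[ℂ] H :=
  ∑ n ∈ Finset.range N, InnerProductSpace.rankOne ℂ (e n) (e n)

lemma headProj_apply (e : HilbertBasis ℕ ℂ H) (N n : ℕ) :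
    headProj e N (e n) = if n < N then e n else 0 := by
  unfold headProj
  rw [sum_apply]
  have h := orthonormal_iff_ite.1 e.orthonormal
  simp [InnerProductSpace.rankOne_apply, h]

lemma star_headProj (e : HilbertBasis ℕ ℂ H) (N : ℕ) : star (headProj e N) = headProj e N := by
  simp [headProj, ContinuousLinearMap.star_eq_adjoint]

lemma hsq_tail (e : HilbertBasis ℕ ℂ H) (V : H →L[ℂ] H) (hV : hsq e V < ∞) :
    Filter.Tendsto (fun N => hsq e (V * (1 - headProj e N))) Filter.atTop (nhds 0) := by
  refine (ENNReal.tendsto_sum_nat_add _ hV.ne).congr fun N => ?_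
  unfold hsq
  rw [← Summable.sum_add_tsum_nat_add' (f := fun n => ‖(V * (1 - headProj e N)) (e n)‖ₑ ^ 2) (k := N)
    ENNReal.summable, Finset.sum_eq_zero, zero_add]
  · refine tsum_congr fun n => ?_
    simp [headProj_apply]
  · intro n hn
    simp [headProj_apply, Finset.mem_range.1 hn]

lemma eq_zero_of_ketbra (e : HilbertBasis ℕ ℂ H) (g : traceClass e →ₗ[ℂ] ℂ) (K : ℝ) (hK : 0 ≤ K)
    (hg : ∀ X, ‖g X‖ ≤ K * norm1 e X) (h0 : ∀ u v, g (ketbra e u v) = 0) : g = 0 := by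
  ext X
  obtain ⟨V, S, hX, hS, hV⟩ := exists_factor e (X : H →L[ℂ] H)
  have hXfin : traceNorm e (X : H →L[ℂ] H) < ∞ := X.2
  have hb : ∀ N, 2 * ‖g X‖ₑ ≤ ENNReal.ofReal K *
      (hsq e (V * (1 - headProj e N)) + hsq e (star S * (1 - headProj e N))) := by
    intro N
    set Q : H →L[ℂ] H := 1 - headProj e N with hQ
    have hQs : star Q = Q := by rw [hQ, star_sub, star_one, star_headProj]
    let XN : traceClass e := ∑ n ∈ Finset.range N, ketbra e (V (e n)) (star S (e n))
    have hXN : (XN : H →L[ℂ] H) = V * headProj e N * S := by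
      simp only [XN, headProj, Submodule.coe_sum, ketbra, Finset.mul_sum, Finset.sum_mul]
      refine Finset.sum_congr rfl fun n _ => ?_
      rw [ContinuousLinearMap.mul_def, ContinuousLinearMap.mul_def,
        InnerProductSpace.comp_rankOne, InnerProductSpace.rankOne_comp]
      rfl
    have hgN : g X = g (X - XN) := by
      rw [map_sub, map_sum, Finset.sum_eq_zero fun n _ => h0 _ _, sub_zero]
    have hQQ : Q * Q = Q := by
      have hPP : headProj e N * headProj e N = headProj e N := by
        conv_lhs => rhs; unfold headProj
        rw [Finset.mul_sum]
        conv_rhs => unfold headProj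
        refine Finset.sum_congr rfl fun n hn => ?_
        rw [ContinuousLinearMap.mul_def, InnerProductSpace.comp_rankOne, headProj_apply,
          if_pos (Finset.mem_range.1 hn)]
      rw [hQ, mul_sub, mul_one, sub_mul, one_mul, hPP, sub_self, sub_zero]
    have hdiff : ((X - XN : traceClass e) : H →L[ℂ] H) = star (star (V * Q)) * star (star S * Q) := by
      rw [star_star, star_mul, star_star, hQs, mul_assoc, ← mul_assoc Q, hQQ,
        Submodule.coe_sub, hXN, hQ, sub_mul, mul_sub, one_mul, ← hX, mul_assoc]
    have h1 := traceNorm_star_mul_le e (star (V * Q)) (star (star S * Q))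
    rw [← hdiff, hsq_star, hsq_star] at h1
    have h2 : ‖g X‖ₑ ≤ ENNReal.ofReal K * traceNorm e ((X - XN : traceClass e) : H →L[ℂ] H) := by
      have := ENNReal.ofReal_le_ofReal (hg (X - XN))
      rwa [← hgN, ofReal_norm, ENNReal.ofReal_mul hK, norm1,
        ENNReal.ofReal_toReal (X - XN).2.ne] at this
    calc 2 * ‖g X‖ₑ ≤ 2 * (ENNReal.ofReal K * traceNorm e ((X - XN : traceClass e) : H →L[ℂ] H)) := by
          gcongr
      _ = ENNReal.ofReal K * (2 * traceNorm e ((X - XN : traceClass e) : H →L[ℂ] H)) := by ring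
      _ ≤ _ := by gcongr
  have hlim := ENNReal.Tendsto.const_mul (a := ENNReal.ofReal K)
    ((hsq_tail e V (hV.trans_lt hXfin)).add
      (hsq_tail e (star S) (by rw [hsq_star, hS]; exact hXfin))) (Or.inr ENNReal.ofReal_ne_top)
  have := ge_of_tendsto' hlim hb
  simpa using this

/-- A trace-norm continuous linear map on trace-class operators has a unique Hilbert–Schmidt
dual. -/
theorem existsUnique_isHSDual (e : HilbertBasis ℕ ℂ H) (Φ : traceClass e →ₗ[ℂ] traceClass e)
    (hΦ : TraceNormContinuous e Φ) : ∃! D, IsHSDual e Φ D := by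
  obtain ⟨C, hC0, hC⟩ := hΦ.exists_bound
  let f : (H →L[ℂ] H) → H → H → ℂ := fun Y v u => traceMul e Y (Φ (ketbra e u v))
  have hf : ∀ Y v u, ‖f Y v u‖ ≤ (‖Y‖ * C) * ‖v‖ * ‖u‖ := fun Y v u => by
    calc ‖f Y v u‖ ≤ ‖Y‖ * norm1 e (Φ (ketbra e u v)) := norm_trace_mul_le e Y _
      _ ≤ ‖Y‖ * (C * (‖u‖ * ‖v‖)) := by
        gcongr
        exact (hC _).trans (by gcongr; exact norm1_ketbra_le e u v)
      _ = _ := by ring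
  let G : (H →L[ℂ] H) → (H →L⋆[ℂ] H →L[ℂ] ℂ) := fun Y =>
    LinearMap.mkContinuous₂ (LinearMap.mk₂'ₛₗ (starRingEnd ℂ) (RingHom.id ℂ) (f Y)
      (fun v v' u => by
        have : ketbra e u (v + v') = ketbra e u v + ketbra e u v' :=
          Subtype.ext (by simp [ketbra])
        simp only [f, this, map_add])
      (fun c v u => by
        have : ketbra e u (c • v) = (starRingEnd ℂ c) • ketbra e u v :=
          Subtype.ext (by simp [ketbra])
        simp only [f, this, map_smul])
      (fun v u u' => by
        have : ketbra e (u + u') v = ketbra e u v + ketbra e u' v :=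
          Subtype.ext (by simp [ketbra])
        simp only [f, this, map_add])
      (fun c v u => by
        have : ketbra e (c • u) v = c • ketbra e u v := Subtype.ext (by simp [ketbra])
        simp only [f, this, map_smul, RingHom.id_apply])) (‖Y‖ * C) (hf Y)
  let D0 : (H →L[ℂ] H) → (H →L[ℂ] H) := fun Y =>
    ContinuousLinearMap.adjoint (InnerProductSpace.continuousLinearMapOfBilin (G Y))
  have hD0 : ∀ Y v u, ⟪v, D0 Y u⟫_ℂ = f Y v u := fun Y v u => by
    rw [ContinuousLinearMap.adjoint_inner_right,
      InnerProductSpace.continuousLinearMapOfBilin_apply]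
    rfl
  let D1 : (H →L[ℂ] H) →ₗ[ℂ] (H →L[ℂ] H) :=
    { toFun := D0
      map_add' := fun Y Y' => by
        ext u
        refine ext_inner_left ℂ fun v => ?_
        rw [add_apply, inner_add_right, hD0, hD0, hD0]
        simp only [f, map_add, LinearMap.add_apply]
      map_smul' := fun c Y => by
        ext u
        refine ext_inner_left ℂ fun v => ?_
        rw [RingHom.id_apply, smul_apply, inner_smul_right, hD0, hD0]
        simp only [f, map_smul, LinearMap.smul_apply, smul_eq_mul] }
  let D : (H →L[ℂ] H) →L[ℂ] (H →L[ℂ] H) := D1.mkContinuous C fun Y => by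
    refine ContinuousLinearMap.opNorm_le_bound _ (by positivity) fun u => ?_
    by_cases h : D0 Y u = 0
    · change ‖D0 Y u‖ ≤ _
      rw [h, norm_zero]; positivity
    have h1 := hf Y (D0 Y u) u
    rw [← hD0, inner_self_eq_norm_sq_to_K] at h1
    have h2 : ‖D0 Y u‖ * ‖D0 Y u‖ ≤ ‖D0 Y u‖ * (C * ‖Y‖ * ‖u‖) := by
      simp at h1
      nlinarith
    exact le_of_mul_le_mul_left h2 (norm_pos_iff.2 h)
  refine ⟨D, fun Y X => ?_, fun D' hD' => ?_⟩
  · have h := eq_zero_of_ketbra e (traceMul e Y ∘ₗ Φ - traceMul e (D Y)) (‖Y‖ * C + ‖D Y‖)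
      (by positivity) (fun X => ?_) (fun u v => ?_)
    · exact sub_eq_zero.1 (LinearMap.congr_fun h X)
    · refine (norm_sub_le _ _).trans ?_
      rw [add_mul, mul_assoc]
      exact add_le_add ((norm_trace_mul_le e Y _).trans (by gcongr; exact hC X))
        (norm_trace_mul_le e _ X)
    · change f Y v u - trace e (D0 Y * InnerProductSpace.rankOne ℂ u v) = 0
      rw [trace_mul_rankOne, hD0, sub_self]
  · ext Y u
    refine ext_inner_left ℂ fun v => ?_
    change _ = ⟪v, D0 Y u⟫_ℂ
    rw [hD0, ← trace_mul_rankOne e]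
    exact (hD' Y (ketbra e u v)).symm

/-- The Hilbert–Schmidt dual `Φ†`, a bounded linear map on bounded operators. -/
def hsDual (e : HilbertBasis ℕ ℂ H) (Φ : traceClass e →ₗ[ℂ] traceClass e)
    (hΦ : TraceNormContinuous e Φ) : (H →L[ℂ] H) →L[ℂ] (H →L[ℂ] H) :=
  (existsUnique_isHSDual e Φ hΦ).choose

theorem isHSDual_hsDual (e : HilbertBasis ℕ ℂ H) (Φ : traceClass e →ₗ[ℂ] traceClass e)
    (hΦ : TraceNormContinuous e Φ) : IsHSDual e Φ (hsDual e Φ hΦ) :=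
  (existsUnique_isHSDual e Φ hΦ).choose_spec.1

/-- A `k × k` block matrix of operators on `H` is positive as an operator on `H^k`. -/
def BlockPositive {k : ℕ} (M : Fin k → Fin k → (H →L[ℂ] H)) : Prop :=
  ∀ v : Fin k → H, 0 ≤ ∑ i, ∑ j, ⟪v i, M i j (v j)⟫_ℂ

/-- Complete positivity: applying `Φ` entrywise preserves positivity of block matrices of
trace-class operators of every size. -/
def IsCompletelyPositive (e : HilbertBasis ℕ ℂ H) (Φ : traceClass e →ₗ[ℂ] traceClass e) : Prop :=
  ∀ (k : ℕ) (X : Fin k → Fin k → traceClass e),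
    BlockPositive (fun i j => (X i j : H →L[ℂ] H)) →
      BlockPositive (fun i j => (Φ (X i j) : H →L[ℂ] H))

/-- A quantum operation: a linear completely positive map on trace-class operators that is
continuous in the trace norm. -/
structure QuantumOperation (e : HilbertBasis ℕ ℂ H) extends traceClass e →ₗ[ℂ] traceClass e where
  completelyPositive : IsCompletelyPositive e toLinearMap
  continuous : TraceNormContinuous e toLinearMap

/-- The Hilbert–Schmidt dual of a quantum operation. -/
def QuantumOperation.dual {e : HilbertBasis ℕ ℂ H} (Φ : QuantumOperation e) :
    (H →L[ℂ] H) →L[ℂ] (H →L[ℂ] H) :=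
  hsDual e Φ.toLinearMap Φ.continuous

/-- `x` lists the eigenvalues of `X` in decreasing order, with multiplicity:
`X = ∑ₖ xₖ |ψₖ⟩⟨ψₖ|` with `ψ` orthonormal and `x₀ ≥ x₁ ≥ …`. -/
def IsEigenvalueSeq (X : H →L[ℂ] H) (x : ℕ → ℝ) : Prop :=
  Antitone x ∧ ∃ ψ : ℕ → H, Orthonormal ℂ ψ ∧
    ∀ v : H, HasSum (fun k => ((x k : ℂ) * ⟪ψ k, v⟫_ℂ) • ψ k) (X v)

open Classical in
/-- The eigenvalues in decreasing order. For a positive trace-class operator this sequence exists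
and is unique; the value for operators that have none is irrelevant. -/
def eigenvalueSeq (X : H →L[ℂ] H) : ℕ → ℝ :=
  if h : ∃ x, IsEigenvalueSeq X x then h.choose else 0

/-- Weak sub-majorization `X ≻_w Y`, for positive trace-class operators. -/
def WeaklySubmajorizes (X Y : H →L[ℂ] H) : Prop :=
  ∀ n : ℕ, ∑ i ∈ Finset.range (n + 1), eigenvalueSeq Y i ≤
    ∑ i ∈ Finset.range (n + 1), eigenvalueSeq X i

/-- The Fock rearrangement `X↓ = ∑ₙ xₙ |n⟩⟨n|` of a positive trace-class operator. -/
def fockRearrangement (e : HilbertBasis ℕ ℂ H) (X : H →L[ℂ] H) : H →L[ℂ] H :=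
  ∑' n, (eigenvalueSeq X n : ℂ) • InnerProductSpace.rankOne ℂ (e n) (e n)

/-- `X` is passive if it coincides with its own Fock rearrangement. -/
def IsPassive (e : HilbertBasis ℕ ℂ H) (X : H →L[ℂ] H) : Prop :=
  X = fockRearrangement e X

/-- `Φ(X)` is passive for every passive positive trace-class `X`. -/
def IsPassivePreserving (e : HilbertBasis ℕ ℂ H) (Φ : traceClass e →ₗ[ℂ] traceClass e) : Prop :=
  ∀ X : traceClass e, 0 ≤ (X : H →L[ℂ] H) → IsPassive e (X : H →L[ℂ] H) →
    IsPassive e (Φ X : H →L[ℂ] H)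

/-- `Φ(X) ≺_w Φ(X↓)` for every positive trace-class `X`; here `Z` is `X↓` as an element of the
space of trace-class operators. -/
def IsFockOptimal (e : HilbertBasis ℕ ℂ H) (Φ : traceClass e →ₗ[ℂ] traceClass e) : Prop :=
  ∀ X Z : traceClass e, 0 ≤ (X : H →L[ℂ] H) →
    (Z : H →L[ℂ] H) = fockRearrangement e (X : H →L[ℂ] H) →
      WeaklySubmajorizes (Φ Z : H →L[ℂ] H) (Φ X : H →L[ℂ] H)

end FockRearrangement

end

open FockRearrangement

noncomputable section
set_option linter.unusedSectionVars false
namespace FockRearrangement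

open scoped ENNReal InnerProductSpace ComplexOrder

variable {H : Type*} [NormedAddCommGroup H] [InnerProductSpace ℂ H] [CompleteSpace H]

/-! Both properties together amount to one condition, `IsHeadOptimal`. Let `P` and `Q` be the
projections onto the first `N` vectors of an orthonormal sequence `ψ` and the first `M` vectors of
`φ`. The condition says that `Tr[Q Φ(P)]` is largest, for all `M` and `N`, when `φ` and `ψ` are both
the Fock basis. Since `Tr[Q Φ(P)] = Tr[Φ†(Q) P]`, passing to the dual only exchanges `(φ, M)` with
`(ψ, N)`, so the condition holds for `Φ` iff it holds for `Φ†` (`isHeadOptimal_dual_iff`).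

That the two properties imply the condition is Ky Fan's principle
(`SpectralExpansion.sum_inner_le`): `Tr[Q Φ(P)]` is at most the sum of the `M` largest eigenvalues
of `Φ(P)`. Fock optimality bounds this by the same sum for `Φ(P↓)`, and passivity of `Φ(P↓)` says
that the Fock basis attains it.

Conversely, a positive `X` is a superposition of its spectral head projections with nonnegative
weights `xₖ - xₖ₊₁`. Abel summation (`hasSum_mul_le_of_antitone`) therefore carries the inequality
from projections to all positive trace-class operators, provided the map acts term by term on
spectral expansions (`IsNormalMap`). For passive `X` this makes the Fock basis a maximizer in Ky
Fan's principle for `Φ(X)`, which forces `Φ(X)` to be passive (`isPassive_of_sum_inner_le`). For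
general `X`, with `φ` an eigenbasis of `Φ(X)`, it is Fock optimality. -/

/-! ### Compactness of trace-class operators -/

/-- Parseval for `A v`, with Cauchy–Schwarz applied to each coefficient `⟨A† eₙ, v⟩`. -/
lemma enorm_le_hsq_rpow (e : HilbertBasis ℕ ℂ H) (A : H →L[ℂ] H) : ‖A‖ₑ ≤ hsq e A ^ (1 / 2 : ℝ) := by
  by_cases hA : hsq e A = ∞
  · simp [hA]
  refine ContinuousLinearMap.opENorm_le_bound _ fun v => ?_
  have h : ‖A v‖ₑ ^ 2 ≤ hsq e A * ‖v‖ₑ ^ 2 := by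
    rw [← tsum_enorm_inner_sq e, ← hsq_star, hsq, ← ENNReal.tsum_mul_right]
    refine ENNReal.tsum_le_tsum fun n => ?_
    rw [← mul_pow, ContinuousLinearMap.star_eq_adjoint, ← ContinuousLinearMap.adjoint_inner_left]
    gcongr
    rw [← ofReal_norm, ← ofReal_norm, ← ofReal_norm, ← ENNReal.ofReal_mul (norm_nonneg _)]
    exact ENNReal.ofReal_le_ofReal (norm_inner_le_norm _ _)
  have h2 := ENNReal.rpow_le_rpow (z := 1 / 2) h (by norm_num)
  rwa [ENNReal.mul_rpow_of_nonneg _ _ (by norm_num), ← ENNReal.rpow_natCast,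
    ← ENNReal.rpow_natCast, ← ENNReal.rpow_mul, ← ENNReal.rpow_mul, Nat.cast_ofNat,
    mul_one_div_cancel two_ne_zero, ENNReal.rpow_one, ENNReal.rpow_one] at h2

lemma isCompactOperator_rankOne (u v : H) :
    IsCompactOperator (InnerProductSpace.rankOne ℂ u v : H →L[ℂ] H) :=
  (isCompactOperator_of_locallyCompactSpace_dom (innerSL ℂ v)).clm_comp
    (ContinuousLinearMap.toSpanSingleton ℂ u)

lemma isCompactOperator_headProj (e : HilbertBasis ℕ ℂ H) (N : ℕ) :
    IsCompactOperator (headProj e N) :=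
  (compactOperator (RingHom.id ℂ) H H).sum_mem (t := Finset.range N)
    (f := fun n => (InnerProductSpace.rankOne ℂ (e n) (e n) : H →L[ℂ] H))
    fun n _ => isCompactOperator_rankOne (e n) (e n)

/-- The finite-rank truncations `A * headProj e N` converge in operator norm, because the
Hilbert–Schmidt norm of the tail dominates the error. -/
lemma isCompactOperator_of_hsq (e : HilbertBasis ℕ ℂ H) (A : H →L[ℂ] H) (hA : hsq e A < ∞) :
    IsCompactOperator A := by
  have h : Filter.Tendsto (fun N => A * headProj e N) Filter.atTop (nhds A) := by
    rw [tendsto_iff_edist_tendsto_0]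
    have h0 := (ENNReal.continuous_rpow_const (y := 1 / 2)).tendsto 0 |>.comp (hsq_tail e A hA)
    rw [ENNReal.zero_rpow_of_pos (by norm_num)] at h0
    refine tendsto_of_tendsto_of_tendsto_of_le_of_le tendsto_const_nhds h0 (fun N => zero_le)
      fun N => ?_
    rw [edist_comm, edist_eq_enorm_sub]
    have := enorm_le_hsq_rpow e (A * (1 - headProj e N))
    rw [Function.comp_apply]
    rwa [show A - A * headProj e N = A * (1 - headProj e N) by rw [mul_sub, mul_one]]
  exact isCompactOperator_of_tendsto h (Filter.Eventually.of_forall fun N =>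
    (isCompactOperator_headProj e N).clm_comp A)

lemma isCompactOperator_of_traceClass (e : HilbertBasis ℕ ℂ H) (X : H →L[ℂ] H)
    (hX : X ∈ traceClass e) : IsCompactOperator X := by
  obtain ⟨V, S, rfl, hS, -⟩ := exists_factor e X
  exact (isCompactOperator_of_hsq e S (hS.trans_lt hX)).clm_comp V

/-! ### Existence of the decreasing eigenvalue sequence -/

/-- The Fock basis is infinite, so the greedy choice of eigenvectors below never runs out of room.
-/
lemma orthogonal_ne_bot (e : HilbertBasis ℕ ℂ H) (W : Submodule ℂ H) [FiniteDimensional ℂ W] :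
    Wᗮ ≠ ⊥ := by
  rw [Ne, Submodule.orthogonal_eq_bot_iff]
  rintro rfl
  have : FiniteDimensional ℂ H := Module.finite_def.2 (Module.Finite.iff_fg.1 ‹_›)
  exact Infinite.not_finite e.orthonormal.linearIndependent.finite

/-- A compact positive operator attains its norm as an eigenvalue. -/
lemma exists_eigenvector_norm (T : H →L[ℂ] H) (hT : 0 ≤ T) (hc : IsCompactOperator T)
    (h0 : T ≠ 0) : ∃ v : H, ‖v‖ = 1 ∧ T v = (‖T‖ : ℂ) • v := by
  have : Nontrivial (H →L[ℂ] H) := ⟨T, 0, h0⟩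
  -- The norm of a positive operator lies in its spectrum, and a nonzero spectral value of a compact
  -- operator is an eigenvalue.
  have h1 : (‖T‖ : ℂ) ∈ spectrum ℂ T :=
    spectrum.algebraMap_mem ℂ (CStarAlgebra.norm_mem_spectrum_of_nonneg hT)
  rw [← hc.hasEigenvalue_iff_mem_spectrum (by simpa using h0)] at h1
  obtain ⟨v, hv⟩ := h1.exists_hasEigenvector
  have hv0 : (‖v‖ : ℂ) ≠ 0 := by simpa using hv.2
  refine ⟨(‖v‖ : ℂ)⁻¹ • v, ?_, ?_⟩
  · rw [norm_smul, norm_inv, Complex.norm_real, norm_norm, inv_mul_cancel₀ (by simpa using hv.2)]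
  · rw [map_smul, smul_comm]
    congr 1
    exact hv.apply_eq_smul

/-- A compact positive operator has, in the orthogonal complement of a finite-dimensional invariant
subspace, an eigenvector whose eigenvalue dominates the operator there. -/
lemma exists_eigenvector_orthogonal (e : HilbertBasis ℕ ℂ H) (X : H →L[ℂ] H) (hX : 0 ≤ X)
    (hc : IsCompactOperator X) (W : Submodule ℂ H) [FiniteDimensional ℂ W]
    (hW : ∀ w ∈ W, X w ∈ W) :
    ∃ v ∈ Wᗮ, ∃ x : ℝ, ‖v‖ = 1 ∧ X v = (x : ℂ) • v ∧ ∀ w ∈ Wᗮ, ‖X w‖ ≤ x * ‖w‖ := by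
  have hpos := (ContinuousLinearMap.nonneg_iff_isPositive _).1 hX
  have hW' : ∀ w ∈ Wᗮ, X w ∈ Wᗮ := fun w hw => by
    rw [Submodule.mem_orthogonal] at hw ⊢
    intro u hu
    rw [← hpos.inner_left_eq_inner_right]
    exact hw _ (hW u hu)
  set P := Wᗮ.starProjection
  -- The compression of `X` to `Wᗮ` is positive and compact on all of `H` and agrees with `X` on
  -- `Wᗮ`, so its norm is the eigenvalue sought.
  set T : H →L[ℂ] H := P ∘L X ∘L P
  have hT : 0 ≤ T :=
    (ContinuousLinearMap.nonneg_iff_isPositive _).2 (hpos.conj_starProjection Wᗮ)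
  have hPw : ∀ w ∈ Wᗮ, P w = w := fun w hw => Submodule.starProjection_eq_self_iff.2 hw
  have hTw : ∀ w ∈ Wᗮ, T w = X w := fun w hw => by
    change P (X (P w)) = X w
    rw [hPw w hw, hPw _ (hW' w hw)]
  have hbound : ∀ w ∈ Wᗮ, ‖X w‖ ≤ ‖T‖ * ‖w‖ := fun w hw => by
    rw [← hTw w hw]
    exact T.le_opNorm w
  -- If the compression vanishes, any unit vector of `Wᗮ` serves, with eigenvalue `0`.
  by_cases h0 : T = 0
  · obtain ⟨u, hu, hu0⟩ := Submodule.exists_mem_ne_zero_of_ne_bot (orthogonal_ne_bot e W)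
    have hu' : ‖u‖ ≠ 0 := by simpa using hu0
    have hv : (‖u‖ : ℂ)⁻¹ • u ∈ Wᗮ := Wᗮ.smul_mem _ hu
    refine ⟨_, hv, ‖T‖, ?_, ?_, hbound⟩
    · rw [norm_smul, norm_inv, Complex.norm_real, norm_norm, inv_mul_cancel₀ hu']
    · rw [← hTw _ hv, h0]; simp
  · obtain ⟨v, hv1, hv⟩ := exists_eigenvector_norm T hT ((hc.comp_clm P).clm_comp P) h0
    have hT0 : (‖T‖ : ℂ) ≠ 0 := by simpa using h0
    have hvW : v ∈ Wᗮ := by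
      have : v = (‖T‖ : ℂ)⁻¹ • T v := by rw [hv, inv_smul_smul₀ hT0]
      rw [this]
      exact Wᗮ.smul_mem _ (Submodule.starProjection_apply_mem _ _)
    exact ⟨v, hvW, ‖T‖, hv1, by rw [← hTw v hvW, hv], hbound⟩

/-- Each summand is `‖√X ψₖ‖²`. Expanding it in the Fock basis and exchanging the sums leaves
Bessel's inequality for `ψ` against each `√X eₙ`. -/
lemma sum_inner_le_traceNorm (e : HilbertBasis ℕ ℂ H) (X : traceClass e)
    (hX : 0 ≤ (X : H →L[ℂ] H)) (ψ : ℕ → H) (hψ : Orthonormal ℂ ψ) (N : ℕ) :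
    ∑ k ∈ Finset.range N, (⟪ψ k, (X : H →L[ℂ] H) (ψ k)⟫_ℂ).re ≤ norm1 e X := by
  set S := CFC.sqrt (X : H →L[ℂ] H)
  have hS : star S = S := (CFC.sqrt_nonneg _).isSelfAdjoint
  have hS' : ∀ u v : H, ⟪S u, v⟫_ℂ = ⟪u, S v⟫_ℂ := fun u v => by
    rw [← ContinuousLinearMap.adjoint_inner_right, ← ContinuousLinearMap.star_eq_adjoint, hS]
  have hSS : S * S = (X : H →L[ℂ] H) := CFC.sqrt_mul_sqrt_self _ hX
  have h1 : ∀ v : H, (⟪v, (X : H →L[ℂ] H) v⟫_ℂ).re = ‖S v‖ ^ 2 := fun v => by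
    rw [← hSS, mul_apply_eq_comp, ← hS', inner_self_eq_norm_sq_to_K]
    norm_cast
  have h2 : ∀ v : H, ENNReal.ofReal (‖v‖ ^ 2) = ‖v‖ₑ ^ 2 := fun v => by
    rw [ENNReal.ofReal_pow (norm_nonneg _), ofReal_norm]
  have hfin : traceNorm e (X : H →L[ℂ] H) < ∞ := X.2
  rw [norm1, ← ENNReal.ofReal_le_iff_le_toReal hfin.ne, traceNorm, CFC.abs_of_nonneg _ hX,
    ENNReal.ofReal_sum_of_nonneg fun k _ => by rw [h1]; positivity]
  simp only [h1, h2]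
  calc ∑ k ∈ Finset.range N, ‖S (ψ k)‖ₑ ^ 2
      = ∑ k ∈ Finset.range N, ∑' n, ‖⟪e n, S (ψ k)⟫_ℂ‖ₑ ^ 2 := by
        simp only [tsum_enorm_inner_sq e]
    _ = ∑' n, ∑ k ∈ Finset.range N, ‖⟪e n, S (ψ k)⟫_ℂ‖ₑ ^ 2 :=
        (Summable.tsum_finsetSum fun _ _ => ENNReal.summable).symm
    _ ≤ ∑' n, ‖S (e n)‖ₑ ^ 2 := by
        refine ENNReal.tsum_le_tsum fun n => ?_
        have h := hψ.sum_inner_products_le (x := S (e n)) (s := Finset.range N)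
        have h' := ENNReal.ofReal_le_ofReal h
        rw [ENNReal.ofReal_sum_of_nonneg fun k _ => by positivity, h2] at h'
        refine le_trans (le_of_eq (Finset.sum_congr rfl fun k _ => ?_)) h'
        rw [← hS', ← inner_conj_symm, ← ofReal_norm, RCLike.norm_conj,
          ENNReal.ofReal_pow (norm_nonneg _)]

/-- Bessel-type expansion: an operator that is diagonal on an orthonormal sequence and small on
the orthogonal complements of its heads is diagonal. -/
lemma hasSum_of_tail (X : H →L[ℂ] H) (x : ℕ → ℝ) (ψ : ℕ → H) (hψ : Orthonormal ℂ ψ)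
    (hx : Filter.Tendsto x Filter.atTop (nhds 0)) (hXψ : ∀ k, X (ψ k) = (x k : ℂ) • ψ k)
    (htail : ∀ n w, (∀ k < n, ⟪ψ k, w⟫_ℂ = 0) → ‖X w‖ ≤ x n * ‖w‖) (v : H) :
    HasSum (fun k => ((x k : ℂ) * ⟪ψ k, v⟫_ℂ) • ψ k) (X v) := by
  have hx0 : ∀ n, 0 ≤ x n := fun n => by
    have h := htail n (ψ n) fun k hk => hψ.2 hk.ne
    rw [hψ.1 n, mul_one] at h
    exact (norm_nonneg _).trans h
  have hs : Summable fun k => ⟪ψ k, v⟫_ℂ • ψ k :=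
    (hψ.orthogonalFamily.summable_iff_norm_sq_summable fun k => ⟪ψ k, v⟫_ℂ).2
      (hψ.inner_products_summable (x := v))
  have h1 := (hs.hasSum.mapL X)
  have h2 : (fun k => X (⟪ψ k, v⟫_ℂ • ψ k)) = fun k => ((x k : ℂ) * ⟪ψ k, v⟫_ℂ) • ψ k := by
    funext k
    rw [map_smul, hXψ, smul_smul, mul_comm]
  rw [h2] at h1
  convert h1 using 1
  -- The residual `v - u` is orthogonal to every `ψ k`, so the tail bound holds for it at every `n`;
  -- as `x n → 0`, `X` kills it.
  set u := ∑' k, ⟪ψ k, v⟫_ℂ • ψ k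
  have hu : ∀ k, ⟪ψ k, v - u⟫_ℂ = 0 := fun k => by
    have h3 := hs.hasSum.mapL (innerSL ℂ (ψ k))
    have h4 : HasSum (fun j => innerSL ℂ (ψ k) (⟪ψ j, v⟫_ℂ • ψ j)) ⟪ψ k, v⟫_ℂ := by
      convert hasSum_ite_eq k ⟪ψ k, v⟫_ℂ using 2 with j
      rw [innerSL_apply_apply, inner_smul_right, orthonormal_iff_ite.1 hψ]
      by_cases hjk : j = k
      · subst hjk; simp
      · simp [hjk, Ne.symm hjk]
    rw [inner_sub_right, sub_eq_zero]
    exact h4.unique h3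
  have h5 : ‖X (v - u)‖ ≤ 0 := by
    have := hx.mul_const ‖v - u‖
    rw [zero_mul] at this
    exact ge_of_tendsto' this fun n => htail n _ fun k _ => hu k
  rw [← sub_eq_zero, ← map_sub]
  exact norm_le_zero_iff.1 h5

/-- Finite-dimensional invariant subspaces. -/
def InvariantSubspace (X : H →L[ℂ] H) : Type _ :=
  {W : Submodule ℂ H // FiniteDimensional ℂ W ∧ ∀ w ∈ W, X w ∈ W}

/-- A greedy construction: enlarge a finite-dimensional invariant subspace by a dominating
eigenvector of its complement, and repeat. The trace norm bounds the sums of the eigenvalues, so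
these tend to `0` and `hasSum_of_tail` applies. The sequence `ψ` need not be complete. -/
theorem exists_isEigenvalueSeq (e : HilbertBasis ℕ ℂ H) (X : traceClass e)
    (hX : 0 ≤ (X : H →L[ℂ] H)) : ∃ x, IsEigenvalueSeq (X : H →L[ℂ] H) x := by
  set T : H →L[ℂ] H := (X : H →L[ℂ] H)
  have hc := isCompactOperator_of_traceClass e T X.2
  have hstep : ∀ W : InvariantSubspace T, ∃ v ∈ W.1ᗮ, ∃ x : ℝ, ‖v‖ = 1 ∧ T v = (x : ℂ) • v ∧
      ∀ w ∈ W.1ᗮ, ‖T w‖ ≤ x * ‖w‖ := fun W => by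
    have := W.2.1
    exact exists_eigenvector_orthogonal e T hX hc W.1 W.2.2
  choose v hvW x hv1 hTv hbound using hstep
  let next : InvariantSubspace T → InvariantSubspace T := fun W =>
    ⟨W.1 ⊔ Submodule.span ℂ {v W}, by
      have := W.2.1
      refine ⟨inferInstance, fun w hw => ?_⟩
      obtain ⟨a, ha, b, hb, rfl⟩ := Submodule.mem_sup.1 hw
      obtain ⟨c, rfl⟩ := Submodule.mem_span_singleton.1 hb
      rw [map_add, map_smul, hTv, smul_smul]
      exact Submodule.add_mem_sup (W.2.2 a ha)
        (Submodule.smul_mem _ _ (Submodule.mem_span_singleton_self _))⟩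
  let W0 : InvariantSubspace T := ⟨⊥, inferInstance, fun w hw => by
    rw [Submodule.mem_bot] at hw ⊢
    rw [hw, map_zero]⟩
  let W : ℕ → InvariantSubspace T := fun n => next^[n] W0
  have hWsucc : ∀ n, W (n + 1) = next (W n) := fun n => Function.iterate_succ_apply' next n W0
  have hW0 : W 0 = W0 := rfl
  have hW1 : ∀ n, (W (n + 1)).1 = (W n).1 ⊔ Submodule.span ℂ {v (W n)} := fun n => by
    rw [hWsucc]
  let ψ : ℕ → H := fun n => v (W n)
  have hmono : Monotone fun n => (W n).1 := monotone_nat_of_le_succ fun n => by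
    rw [hW1]; exact le_sup_left
  have hmem : ∀ m n, m < n → ψ m ∈ (W n).1 := fun m n hmn => by
    refine hmono hmn ?_
    change _ ∈ (W (m + 1)).1
    rw [hW1]
    exact (le_sup_right : _ ≤ (W m).1 ⊔ _) (Submodule.mem_span_singleton_self _)
  have hψ : Orthonormal ℂ ψ := by
    refine ⟨fun n => hv1 _, fun m n hmn => ?_⟩
    rcases lt_or_gt_of_ne hmn with h | h
    · exact Submodule.inner_right_of_mem_orthogonal (hmem m n h) (hvW (W n))
    · exact Submodule.inner_left_of_mem_orthogonal (hmem n m h) (hvW (W m))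
  have hperp : ∀ n w, (∀ k < n, ⟪ψ k, w⟫_ℂ = 0) → w ∈ (W n).1ᗮ := by
    intro n w
    induction n with
    | zero => intro _; rw [hW0]; simp [W0]
    | succ n ih =>
      intro h
      rw [hW1, ← Submodule.inf_orthogonal]
      refine ⟨ih fun k hk => h k (by omega), ?_⟩
      exact Submodule.mem_orthogonal_singleton_iff_inner_right.2 (h n (by omega))
  have htail : ∀ n w, (∀ k < n, ⟪ψ k, w⟫_ℂ = 0) → ‖T w‖ ≤ x (W n) * ‖w‖ := fun n w h =>
    hbound (W n) w (hperp n w h)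
  have hx : ∀ k, (⟪ψ k, T (ψ k)⟫_ℂ).re = x (W k) := fun k => by
    rw [hTv, inner_smul_right, inner_self_eq_norm_sq_to_K, hψ.1 k]
    simp
  have hx0 : ∀ k, 0 ≤ x (W k) := fun k => by
    have h := htail k (ψ k) fun j hj => hψ.2 hj.ne
    rw [hψ.1 k, mul_one] at h
    exact (norm_nonneg _).trans h
  have hsum : Summable fun k => x (W k) :=
    summable_of_sum_range_le hx0 fun N => by
      have h := sum_inner_le_traceNorm e X hX ψ hψ N
      simpa only [← hx] using h
  refine ⟨fun k => x (W k), antitone_nat_of_succ_le fun n => ?_, ψ, hψ,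
    hasSum_of_tail T _ ψ hψ hsum.tendsto_atTop_zero (fun k => hTv _) htail⟩
  -- The vector `ψ (n + 1)` already lay in the complement at stage `n`, where the eigenvalue `x (W
  -- n)` dominates.
  have h := htail n (ψ (n + 1)) fun k hk => hψ.2 (by omega)
  rw [hTv, norm_smul, hψ.1, mul_one, mul_one, Complex.norm_real] at h
  exact (le_abs_self _).trans h

/-! ### Spectral expansions and Ky Fan's principle -/

/-- `X = ∑ₖ xₖ |ψₖ⟩⟨ψₖ|` with `x` decreasing and `ψ` orthonormal. -/
def SpectralExpansion (X : H →L[ℂ] H) (x : ℕ → ℝ) (ψ : ℕ → H) : Prop :=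
  Antitone x ∧ Orthonormal ℂ ψ ∧ ∀ v : H, HasSum (fun k => ((x k : ℂ) * ⟪ψ k, v⟫_ℂ) • ψ k) (X v)

/-- Abel summation: the partial sums of `x d` are nonnegative if those of `d` are and `x` is
decreasing and nonnegative. -/
lemma sum_mul_nonneg_of_antitone {x d : ℕ → ℝ} (hx : Antitone x) (hx0 : ∀ n, 0 ≤ x n)
    (hd : ∀ n, 0 ≤ ∑ k ∈ Finset.range n, d k) (n : ℕ) : 0 ≤ ∑ k ∈ Finset.range n, x k * d k := by
  -- Nonnegativity alone does not pass from `n` to `n + 1`; this stronger lower bound does.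
  have h : ∀ n, x n * ∑ k ∈ Finset.range (n + 1), d k ≤
      ∑ k ∈ Finset.range (n + 1), x k * d k := by
    intro n
    induction n with
    | zero => simp
    | succ n ih =>
      rw [Finset.sum_range_succ _ (n + 1), Finset.sum_range_succ (fun k => x k * d k) (n + 1),
        mul_add]
      have := mul_le_mul_of_nonneg_right (hx n.le_succ) (hd (n + 1))
      exact add_le_add_left (this.trans ih) _
  cases n with
  | zero => simp
  | succ n => exact (mul_nonneg (hx0 n) (hd _)).trans (h n)

/-- Abel summation for `d = q - p`, then a limit of partial sums. It serves both Ky Fan's principle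
and the passage from projections to general positive operators. -/
lemma hasSum_mul_le_of_antitone {x p q : ℕ → ℝ} (hx : Antitone x) (hx0 : ∀ n, 0 ≤ x n)
    (hpq : ∀ n, ∑ k ∈ Finset.range n, p k ≤ ∑ k ∈ Finset.range n, q k) {a b : ℝ}
    (ha : HasSum (fun k => x k * p k) a) (hb : HasSum (fun k => x k * q k) b) : a ≤ b := by
  refine le_of_tendsto_of_tendsto' ha.tendsto_sum_nat hb.tendsto_sum_nat fun n => ?_
  rw [← sub_nonneg, ← Finset.sum_sub_distrib]
  simp only [← mul_sub]
  refine sum_mul_nonneg_of_antitone hx hx0 (fun n => ?_) n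
  rw [Finset.sum_sub_distrib, sub_nonneg]
  exact hpq n

namespace SpectralExpansion

variable {X : H →L[ℂ] H} {x : ℕ → ℝ} {ψ : ℕ → H}

lemma apply (h : SpectralExpansion X x ψ) (k : ℕ) : X (ψ k) = (x k : ℂ) • ψ k := by
  refine (h.2.2 (ψ k)).unique ?_
  convert hasSum_ite_eq k ((x k : ℂ) • ψ k) using 2 with j
  rw [orthonormal_iff_ite.1 h.2.1]
  by_cases hjk : j = k
  · subst hjk; simp
  · simp [hjk]

lemma re_inner (h : SpectralExpansion X x ψ) (k : ℕ) : (⟪ψ k, X (ψ k)⟫_ℂ).re = x k := by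
  rw [h.apply, inner_smul_right, inner_self_eq_norm_sq_to_K, h.2.1.1 k]
  simp

lemma nonneg (h : SpectralExpansion X x ψ) (hX : 0 ≤ X) (k : ℕ) : 0 ≤ x k := by
  rw [← h.re_inner]
  exact ((ContinuousLinearMap.nonneg_iff_isPositive _).1 hX).re_inner_nonneg_right _

lemma hasSum_inner (h : SpectralExpansion X x ψ) (v : H) :
    HasSum (fun k => x k * ‖⟪ψ k, v⟫_ℂ‖ ^ 2) (⟪v, X v⟫_ℂ).re := by
  convert ((h.2.2 v).mapL (innerSL ℂ v)).mapL Complex.reCLM using 2 with k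
  · rw [innerSL_apply_apply, inner_smul_right, mul_assoc, ← inner_conj_symm v, Complex.mul_conj,
      Complex.normSq_eq_norm_sq, Complex.reCLM_apply, Complex.re_ofReal_mul, Complex.ofReal_re]
  · rfl

/-- Ky Fan's maximum principle. -/
lemma sum_inner_le (h : SpectralExpansion X x ψ) (hX : 0 ≤ X) {φ : ℕ → H} (hφ : Orthonormal ℂ φ)
    (M : ℕ) : ∑ i ∈ Finset.range M, (⟪φ i, X (φ i)⟫_ℂ).re ≤ ∑ i ∈ Finset.range M, x i := by
  -- Both sides become sums of the eigenvalues `x k` against weights: the overlaps of `ψ k` with the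
  -- first `M` vectors of `φ`, and the indicator of `k < M`.
  have h1 : HasSum (fun k => x k * ∑ i ∈ Finset.range M, ‖⟪ψ k, φ i⟫_ℂ‖ ^ 2)
      (∑ i ∈ Finset.range M, (⟪φ i, X (φ i)⟫_ℂ).re) := by
    simp only [Finset.mul_sum]
    exact hasSum_sum fun i _ => h.hasSum_inner (φ i)
  have h2 : HasSum (fun k => x k * if k < M then 1 else 0) (∑ i ∈ Finset.range M, x i) := by
    convert hasSum_sum_of_ne_finset_zero (s := Finset.range M)
      (f := fun k => x k * if k < M then 1 else 0) (fun k hk => ?_) using 1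
    · exact Finset.sum_congr rfl fun k hk => by simp [Finset.mem_range.1 hk]
    · simp at hk; simp [hk]
    · infer_instance
  refine hasSum_mul_le_of_antitone h.1 (h.nonneg hX) (fun N => ?_) h1 h2
  have h3 : ∑ k ∈ Finset.range N, (if k < M then (1 : ℝ) else 0) = (min N M : ℕ) := by
    rw [Finset.sum_boole]
    congr 1
    rw [show (Finset.range N).filter (· < M) = Finset.range (min N M) by ext; simp,
      Finset.card_range]
  rw [h3, Nat.cast_min]
  -- The first `N` overlap weights sum to at most `N` by Bessel for `φ`, and to at most `M` by
  -- Bessel for `ψ`.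
  refine le_min ?_ ?_
  · calc _ ≤ ∑ k ∈ Finset.range N, (1 : ℝ) := Finset.sum_le_sum fun k _ => by
          have := hφ.sum_inner_products_le (x := ψ k) (s := Finset.range M)
          rw [h.2.1.1 k, one_pow] at this
          refine le_trans (le_of_eq (Finset.sum_congr rfl fun i _ => ?_)) this
          rw [← inner_conj_symm, RCLike.norm_conj]
      _ = N := by simp
  · rw [Finset.sum_comm]
    calc _ ≤ ∑ i ∈ Finset.range M, (1 : ℝ) := Finset.sum_le_sum fun i _ => by
          have := h.2.1.sum_inner_products_le (x := φ i) (s := Finset.range N)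
          rwa [hφ.1 i, one_pow] at this
      _ = M := by simp

lemma sum_inner_eq (h : SpectralExpansion X x ψ) (M : ℕ) :
    ∑ i ∈ Finset.range M, (⟪ψ i, X (ψ i)⟫_ℂ).re = ∑ i ∈ Finset.range M, x i :=
  Finset.sum_congr rfl fun i _ => h.re_inner i

/-- The partial sums of both sequences are the Ky Fan maxima of `X`, which do not depend on the
expansion. -/
lemma unique (h : SpectralExpansion X x ψ) (hX : 0 ≤ X) {y : ℕ → ℝ} {φ : ℕ → H}
    (h' : SpectralExpansion X y φ) : x = y := by
  have hs : ∀ M, ∑ i ∈ Finset.range M, x i = ∑ i ∈ Finset.range M, y i := fun M =>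
    le_antisymm (h.sum_inner_eq M ▸ h'.sum_inner_le hX h.2.1 M)
      (h'.sum_inner_eq M ▸ h.sum_inner_le hX h'.2.1 M)
  funext n
  have h1 := hs (n + 1)
  rw [Finset.sum_range_succ, Finset.sum_range_succ, hs n] at h1
  exact add_left_cancel h1

lemma eigenvalueSeq_eq (h : SpectralExpansion X x ψ) (hX : 0 ≤ X) : eigenvalueSeq X = x := by
  have hex : ∃ x, IsEigenvalueSeq X x := ⟨x, h.1, ψ, h.2⟩
  rw [eigenvalueSeq, dif_pos hex]
  obtain ⟨hy, φ, hφ⟩ := hex.choose_spec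
  exact unique ⟨hy, hφ⟩ hX h

lemma eq_of_same (h : SpectralExpansion X x ψ) {Y : H →L[ℂ] H} (h' : SpectralExpansion Y x ψ) :
    X = Y :=
  ContinuousLinearMap.ext fun v => (h.2.2 v).unique (h'.2.2 v)

lemma summable {e : HilbertBasis ℕ ℂ H} {X : traceClass e}
    (h : SpectralExpansion (X : H →L[ℂ] H) x ψ) (hX : 0 ≤ (X : H →L[ℂ] H)) : Summable x :=
  summable_of_sum_range_le (h.nonneg hX) fun N => by
    rw [← h.sum_inner_eq]
    exact sum_inner_le_traceNorm e X hX ψ h.2.1 N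

end SpectralExpansion

/-! ### Fock rearrangements and passive operators -/

lemma exists_spectralExpansion (e : HilbertBasis ℕ ℂ H) (X : traceClass e)
    (hX : 0 ≤ (X : H →L[ℂ] H)) :
    ∃ ψ, SpectralExpansion (X : H →L[ℂ] H) (eigenvalueSeq (X : H →L[ℂ] H)) ψ := by
  obtain ⟨x, hx, ψ, hψ⟩ := exists_isEigenvalueSeq e X hX
  have h : SpectralExpansion (X : H →L[ℂ] H) x ψ := ⟨hx, hψ⟩
  exact ⟨ψ, (h.eigenvalueSeq_eq hX).symm ▸ h⟩

/-- Summability of the eigenvalues makes the `tsum` in `fockRearrangement` converge in operator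
norm, so it does not take its default value `0`. -/
lemma spectralExpansion_fockRearrangement (e : HilbertBasis ℕ ℂ H) (X : traceClass e)
    (hX : 0 ≤ (X : H →L[ℂ] H)) :
    SpectralExpansion (fockRearrangement e (X : H →L[ℂ] H)) (eigenvalueSeq (X : H →L[ℂ] H)) e := by
  obtain ⟨ψ, h⟩ := exists_spectralExpansion e X hX
  have hs : Summable fun n => (eigenvalueSeq (X : H →L[ℂ] H) n : ℂ) •
      (InnerProductSpace.rankOne ℂ (e n) (e n) : H →L[ℂ] H) := by
    refine Summable.of_norm_bounded (h.summable hX) fun n => ?_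
    rw [norm_smul, InnerProductSpace.norm_rankOne, e.orthonormal.1 n, Complex.norm_real,
      Real.norm_of_nonneg (h.nonneg hX n)]
    simp
  refine ⟨h.1, e.orthonormal, fun v => ?_⟩
  convert hs.hasSum.mapL (ContinuousLinearMap.apply ℂ H v) using 2 with n
  · simp [mul_smul]
  · rfl

lemma isPassive_iff (e : HilbertBasis ℕ ℂ H) (X : traceClass e) (hX : 0 ≤ (X : H →L[ℂ] H)) :
    IsPassive e (X : H →L[ℂ] H) ↔
      SpectralExpansion (X : H →L[ℂ] H) (eigenvalueSeq (X : H →L[ℂ] H)) e := by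
  have h := spectralExpansion_fockRearrangement e X hX
  refine ⟨fun hp => ?_, fun hp => hp.eq_of_same h⟩
  rw [IsPassive] at hp
  rwa [← hp] at h

lemma SpectralExpansion.isPassive {e : HilbertBasis ℕ ℂ H} {X : traceClass e} {x : ℕ → ℝ}
    (h : SpectralExpansion (X : H →L[ℂ] H) x e) (hX : 0 ≤ (X : H →L[ℂ] H)) :
    IsPassive e (X : H →L[ℂ] H) := by
  rw [isPassive_iff e X hX, h.eigenvalueSeq_eq hX]
  exact h

lemma spectralExpansion_of_apply (e : HilbertBasis ℕ ℂ H) {X : H →L[ℂ] H} {x : ℕ → ℝ}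
    (hx : Antitone x) (hX : ∀ n, X (e n) = (x n : ℂ) • e n) : SpectralExpansion X x e := by
  refine ⟨hx, e.orthonormal, fun v => ?_⟩
  convert (e.hasSum_repr v).mapL X using 2 with n
  rw [map_smul, hX, smul_smul, mul_comm, e.repr_apply_apply]

/-- A positive trace-class operator is passive if the heads of the Fock basis maximize the sums of
its diagonal elements. -/
lemma isPassive_of_sum_inner_le (e : HilbertBasis ℕ ℂ H) (Y : traceClass e)
    (hY : 0 ≤ (Y : H →L[ℂ] H))
    (hmax : ∀ φ : ℕ → H, Orthonormal ℂ φ → ∀ M,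
      ∑ i ∈ Finset.range M, (⟪φ i, (Y : H →L[ℂ] H) (φ i)⟫_ℂ).re ≤
        ∑ i ∈ Finset.range M, (⟪e i, (Y : H →L[ℂ] H) (e i)⟫_ℂ).re) :
    IsPassive e (Y : H →L[ℂ] H) := by
  obtain ⟨ψ, h⟩ := exists_spectralExpansion e Y hY
  set T : H →L[ℂ] H := (Y : H →L[ℂ] H)
  set y := eigenvalueSeq T
  -- Ky Fan gives one inequality and maximality, tested on an eigenbasis, the other; differences
  -- then identify the diagonal of `T` with its eigenvalues.
  have hs : ∀ M, ∑ i ∈ Finset.range M, (⟪e i, T (e i)⟫_ℂ).re = ∑ i ∈ Finset.range M, y i :=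
    fun M => le_antisymm (h.sum_inner_le hY e.orthonormal M)
      (h.sum_inner_eq M ▸ hmax ψ h.2.1 M)
  have hd : ∀ n, (⟪e n, T (e n)⟫_ℂ).re = y n := fun n => by
    have h1 := hs (n + 1)
    rw [Finset.sum_range_succ, Finset.sum_range_succ, hs n] at h1
    exact add_left_cancel h1
  -- Pythagoras. Summed over `n`, the left side is `‖T‖₂² = ∑ yₖ²`, computed in the eigenbasis, so
  -- the off-diagonal parts must all vanish.
  have hnorm : ∀ n, ‖T (e n)‖ ^ 2 = ‖T (e n) - (y n : ℂ) • e n‖ ^ 2 + y n ^ 2 := fun n => by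
    rw [@norm_sub_sq ℂ, inner_smul_right, ← inner_conj_symm, norm_smul, e.orthonormal.1 n]
    have : RCLike.re ((y n : ℂ) * (starRingEnd ℂ) ⟪e n, T (e n)⟫_ℂ) = y n * y n := by
      change ((y n : ℂ) * (starRingEnd ℂ) ⟪e n, T (e n)⟫_ℂ).re = _
      rw [Complex.re_ofReal_mul, Complex.conj_re, hd]
    rw [this, Complex.norm_real, mul_one, Real.norm_eq_abs, sq_abs]
    ring
  have hpos := (ContinuousLinearMap.nonneg_iff_isPositive _).1 hY
  have hhs : hsq e T = ∑' k, ENNReal.ofReal (y k ^ 2) := by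
    have h1 : ∀ n, ‖T (e n)‖ₑ ^ 2 = ∑' k, ‖⟪ψ k, T (e n)⟫_ℂ‖ₑ ^ 2 := by
      intro n
      have h2 := ((h.2.2 (e n)).mapL (innerSL ℂ (T (e n)))).mapL Complex.reCLM
      have h3 : HasSum (fun k => ‖⟪ψ k, T (e n)⟫_ℂ‖ ^ 2) (‖T (e n)‖ ^ 2) := by
        convert h2 using 2 with k
        · have hk : (y k : ℂ) * ⟪ψ k, e n⟫_ℂ = ⟪ψ k, T (e n)⟫_ℂ := by
            rw [← hpos.inner_left_eq_inner_right, h.apply, inner_smul_left, Complex.conj_ofReal]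
          rw [innerSL_apply_apply, inner_smul_right, hk, ← inner_conj_symm (T (e n)),
            Complex.mul_conj, Complex.normSq_eq_norm_sq, Complex.reCLM_apply, Complex.ofReal_re]
        · rw [innerSL_apply_apply, inner_self_eq_norm_sq_to_K, Complex.reCLM_apply]
          norm_cast
      rw [← ofReal_norm, ← ENNReal.ofReal_pow (norm_nonneg _), ← h3.tsum_eq,
        ENNReal.ofReal_tsum_of_nonneg (fun k => by positivity) h3.summable]
      exact tsum_congr fun k => by rw [ENNReal.ofReal_pow (norm_nonneg _), ofReal_norm]
    unfold hsq
    simp only [h1]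
    rw [ENNReal.tsum_comm]
    refine tsum_congr fun k => ?_
    have h2 : ∀ n, ‖⟪ψ k, T (e n)⟫_ℂ‖ₑ ^ 2 = ENNReal.ofReal (y k ^ 2) * ‖⟪e n, ψ k⟫_ℂ‖ₑ ^ 2 := by
      intro n
      rw [← hpos.inner_left_eq_inner_right, h.apply, inner_smul_left, Complex.conj_ofReal,
        enorm_mul, mul_pow, ← inner_conj_symm, ← ofReal_norm, ← ofReal_norm, ← ofReal_norm,
        RCLike.norm_conj, Complex.norm_real, Real.norm_eq_abs, ← ENNReal.ofReal_pow (abs_nonneg _),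
        sq_abs]
    simp only [h2]
    rw [ENNReal.tsum_mul_left, tsum_enorm_inner_sq, ← ofReal_norm, h.2.1.1 k]
    simp
  -- Finiteness permits the cancellation in `ℝ≥0∞`; it follows from `yₖ² ≤ y₀ yₖ`.
  have hfin : ∑' k, ENNReal.ofReal (y k ^ 2) ≠ ∞ := by
    have hsum : Summable fun k => y k ^ 2 := by
      refine Summable.of_nonneg_of_le (fun k => sq_nonneg _) (fun k => ?_)
        ((h.summable hY).mul_left (y 0))
      rw [sq]
      exact mul_le_mul_of_nonneg_right (h.1 (Nat.zero_le k)) (h.nonneg hY k)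
    rw [← ENNReal.ofReal_tsum_of_nonneg (fun k => sq_nonneg _) hsum]
    exact ENNReal.ofReal_ne_top
  have hzero : ∑' n, ENNReal.ofReal (‖T (e n) - (y n : ℂ) • e n‖ ^ 2) = 0 := by
    have h1 : hsq e T = ∑' n, ENNReal.ofReal (‖T (e n) - (y n : ℂ) • e n‖ ^ 2) +
        ∑' k, ENNReal.ofReal (y k ^ 2) := by
      rw [← ENNReal.tsum_add]
      refine tsum_congr fun n => ?_
      rw [← ENNReal.ofReal_add (by positivity) (by positivity), ← hnorm,
        ENNReal.ofReal_pow (norm_nonneg _), ofReal_norm]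
    rw [hhs] at h1
    exact ((ENNReal.add_left_inj hfin).1 ((zero_add _).trans h1)).symm
  refine SpectralExpansion.isPassive (spectralExpansion_of_apply e h.1 fun n => ?_) hY
  have h1 := ENNReal.tsum_eq_zero.1 hzero n
  rw [ENNReal.ofReal_eq_zero] at h1
  have h2 : ‖T (e n) - (y n : ℂ) • e n‖ = 0 := pow_eq_zero_iff two_ne_zero |>.1
    (le_antisymm h1 (by positivity))
  exact sub_eq_zero.1 (norm_eq_zero.1 h2)

/-! ### Traces and spectral expansions -/

lemma hasSum_norm_inner_sq (e : HilbertBasis ℕ ℂ H) (v : H) :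
    HasSum (fun n => ‖⟪e n, v⟫_ℂ‖ ^ 2) (‖v‖ ^ 2) := by
  convert (e.hasSum_inner_mul_inner v v).mapL Complex.reCLM using 2 with n
  · rw [← inner_conj_symm v (e n), Complex.reCLM_apply, mul_comm, Complex.mul_conj,
      Complex.normSq_eq_norm_sq, Complex.ofReal_re]
  · rw [inner_self_eq_norm_sq_to_K, Complex.reCLM_apply]; norm_cast

/-- Fubini for the double family `F` over eigenvectors and Fock states: summing over Fock states
first gives the expansion by Parseval, summing over eigenvectors first gives the trace. The majorant
`G` comes from `ab ≤ a² + b²` and the summability of `x`. -/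
lemma SpectralExpansion.hasSum_trace_mul {e : HilbertBasis ℕ ℂ H} {X : traceClass e}
    {x : ℕ → ℝ} {ψ : ℕ → H} (h : SpectralExpansion (X : H →L[ℂ] H) x ψ)
    (hX : 0 ≤ (X : H →L[ℂ] H)) (A : H →L[ℂ] H) :
    HasSum (fun k => (x k : ℂ) * ⟪ψ k, A (ψ k)⟫_ℂ) (trace e (A * (X : H →L[ℂ] H))) := by
  let F : ℕ × ℕ → ℂ := fun p => (x p.1 : ℂ) * (⟪ψ p.1, e p.2⟫_ℂ * ⟪e p.2, A (ψ p.1)⟫_ℂ)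
  let G : ℕ × ℕ → ℝ := fun p => x p.1 * (‖⟪e p.2, ψ p.1⟫_ℂ‖ ^ 2 + ‖⟪e p.2, A (ψ p.1)⟫_ℂ‖ ^ 2)
  have hx0 := h.nonneg hX
  have hGfib : ∀ k, HasSum (fun n => G (k, n)) (x k * (‖ψ k‖ ^ 2 + ‖A (ψ k)‖ ^ 2)) := fun k =>
    ((hasSum_norm_inner_sq e _).add (hasSum_norm_inner_sq e _)).mul_left _
  have hG : Summable G := by
    refine (summable_prod_of_nonneg fun p => mul_nonneg (hx0 _) (by positivity)).2
      ⟨fun k => (hGfib k).summable, ?_⟩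
    rw [show (fun k => ∑' n, G (k, n)) = fun k => x k * (‖ψ k‖ ^ 2 + ‖A (ψ k)‖ ^ 2) from
      funext fun k => (hGfib k).tsum_eq]
    refine Summable.of_nonneg_of_le (fun k => mul_nonneg (hx0 _) (by positivity)) (fun k => ?_)
      ((h.summable hX).mul_right (1 + ‖A‖ ^ 2))
    have h1 : ‖A (ψ k)‖ ≤ ‖A‖ := by
      have := A.le_opNorm (ψ k)
      rwa [h.2.1.1 k, mul_one] at this
    rw [h.2.1.1 k, one_pow]
    have := hx0 k
    gcongr
  have hF : Summable F := by
    refine Summable.of_norm_bounded hG fun p => ?_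
    rw [norm_mul, norm_mul, Complex.norm_real, Real.norm_of_nonneg (hx0 _), ← inner_conj_symm,
      RCLike.norm_conj]
    have := two_mul_le_add_sq ‖⟪e p.2, ψ p.1⟫_ℂ‖ ‖⟪e p.2, A (ψ p.1)⟫_ℂ‖
    refine mul_le_mul_of_nonneg_left ?_ (hx0 _)
    nlinarith [norm_nonneg ⟪e p.2, ψ p.1⟫_ℂ, norm_nonneg ⟪e p.2, A (ψ p.1)⟫_ℂ]
  have h1 : HasSum (fun k => (x k : ℂ) * ⟪ψ k, A (ψ k)⟫_ℂ) (∑' p, F p) :=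
    hF.hasSum.prod_fiberwise fun k => (e.hasSum_inner_mul_inner (ψ k) (A (ψ k))).mul_left _
  have h2 : HasSum (fun n => ⟪e n, (A * (X : H →L[ℂ] H)) (e n)⟫_ℂ) (∑' p, F p) := by
    have hsw := (Equiv.prodComm ℕ ℕ).hasSum_iff.2 hF.hasSum
    refine hsw.prod_fiberwise fun n => ?_
    refine (((h.2.2 (e n)).mapL A).mapL (innerSL ℂ (e n))).congr_fun fun k => ?_
    rw [map_smul, innerSL_apply_apply, inner_smul_right, mul_assoc]
    rfl
  rwa [trace, h2.tsum_eq]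

/-- As `X` is self-adjoint, `Tr[X A]` is the conjugate of `Tr[A† X]`. This order of factors is the
one met when `X` is the argument of the dual. -/
lemma SpectralExpansion.hasSum_trace_mul' {e : HilbertBasis ℕ ℂ H} {X : traceClass e}
    {x : ℕ → ℝ} {ψ : ℕ → H} (h : SpectralExpansion (X : H →L[ℂ] H) x ψ)
    (hX : 0 ≤ (X : H →L[ℂ] H)) (A : H →L[ℂ] H) :
    HasSum (fun k => (x k : ℂ) * ⟪ψ k, A (ψ k)⟫_ℂ) (trace e ((X : H →L[ℂ] H) * A)) := by
  have hpos := (ContinuousLinearMap.nonneg_iff_isPositive _).1 hX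
  have h1 := (Complex.hasSum_conj'.2 (h.hasSum_trace_mul hX (star A)))
  convert h1 using 1
  · funext k
    rw [map_mul, Complex.conj_ofReal, inner_conj_symm, ContinuousLinearMap.star_eq_adjoint,
      ContinuousLinearMap.adjoint_inner_left]
  · rw [trace, trace, Complex.conj_tsum]
    refine tsum_congr fun n => ?_
    rw [inner_conj_symm, mul_apply_eq_comp, mul_apply_eq_comp,
      ContinuousLinearMap.star_eq_adjoint, ContinuousLinearMap.adjoint_inner_left,
      hpos.inner_left_eq_inner_right]

lemma trace_rankOne_mul (e : HilbertBasis ℕ ℂ H) (A : H →L[ℂ] H) (u v : H) :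
    trace e (InnerProductSpace.rankOne ℂ u v * A) = ⟪v, A u⟫_ℂ := by
  rw [← ContinuousLinearMap.adjoint_inner_left, ← e.tsum_inner_mul_inner]
  refine tsum_congr fun n => ?_
  rw [mul_apply_eq_comp, InnerProductSpace.rankOne_apply, inner_smul_right,
    ContinuousLinearMap.adjoint_inner_left]

lemma nonneg_of_inner_nonneg {A : H →L[ℂ] H} (h : ∀ v, 0 ≤ ⟪v, A v⟫_ℂ) : 0 ≤ A := by
  rw [ContinuousLinearMap.nonneg_iff_isPositive, ContinuousLinearMap.isPositive_iff_complex]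
  intro v
  obtain ⟨h1, h2⟩ := Complex.nonneg_iff.1 (h v)
  rw [← inner_conj_symm, Complex.conj_eq_iff_im.2 h2.symm]
  exact ⟨Complex.ext rfl h2, h1⟩

/-! ### Maps optimal on the heads of the Fock basis -/

/-- The trace-class operator `∑_{k < N} |ψₖ⟩⟨ψₖ|`. -/
def headSum (e : HilbertBasis ℕ ℂ H) (ψ : ℕ → H) (N : ℕ) : traceClass e :=
  ∑ k ∈ Finset.range N, ketbra e (ψ k) (ψ k)

lemma headSum_nonneg (e : HilbertBasis ℕ ℂ H) (ψ : ℕ → H) (N : ℕ) :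
    0 ≤ (headSum e ψ N : H →L[ℂ] H) := by
  rw [headSum, Submodule.coe_sum]
  exact Finset.sum_nonneg fun k _ => (ContinuousLinearMap.nonneg_iff_isPositive _).2
    (InnerProductSpace.isPositive_rankOne_self (ψ k))

lemma spectralExpansion_headSum (e : HilbertBasis ℕ ℂ H) {ψ : ℕ → H} (hψ : Orthonormal ℂ ψ)
    (N : ℕ) : SpectralExpansion (headSum e ψ N : H →L[ℂ] H) (fun k => if k < N then 1 else 0) ψ := by
  refine ⟨fun a b hab => ?_, hψ, fun v => ?_⟩
  · dsimp only
    split_ifs <;> first | omega | norm_num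
  · have h : (headSum e ψ N : H →L[ℂ] H) v = ∑ k ∈ Finset.range N,
        (((if k < N then 1 else 0 : ℝ) : ℂ) * ⟪ψ k, v⟫_ℂ) • ψ k := by
      rw [headSum, Submodule.coe_sum, sum_apply]
      refine Finset.sum_congr rfl fun k hk => ?_
      simp [ketbra, Finset.mem_range.1 hk]
    rw [h]
    exact hasSum_sum_of_ne_finset_zero fun k hk => by
      simp at hk; simp [hk]

/-- Among all orthonormal sequences `φ`, `ψ`, the Fock basis maximizes
`∑_{i < M} ∑_{k < N} ⟨φᵢ, Ψ(|ψₖ⟩⟨ψₖ|) φᵢ⟩` for all `M` and `N`. -/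
def IsHeadOptimal (e : HilbertBasis ℕ ℂ H) (Ψ : traceClass e →ₗ[ℂ] traceClass e) : Prop :=
  ∀ φ ψ : ℕ → H, Orthonormal ℂ φ → Orthonormal ℂ ψ → ∀ M N : ℕ,
    ∑ i ∈ Finset.range M, ∑ k ∈ Finset.range N,
        (⟪φ i, (Ψ (ketbra e (ψ k) (ψ k)) : H →L[ℂ] H) (φ i)⟫_ℂ).re ≤
      ∑ i ∈ Finset.range M, ∑ k ∈ Finset.range N,
        (⟪e i, (Ψ (ketbra e (e k) (e k)) : H →L[ℂ] H) (e i)⟫_ℂ).re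

/-- `Ψ` preserves positivity. -/
def IsPositivePreserving (e : HilbertBasis ℕ ℂ H) (Ψ : traceClass e →ₗ[ℂ] traceClass e) : Prop :=
  ∀ X : traceClass e, 0 ≤ (X : H →L[ℂ] H) → 0 ≤ (Ψ X : H →L[ℂ] H)

/-- `Ψ` can be applied term by term to spectral expansions. -/
def IsNormalMap (e : HilbertBasis ℕ ℂ H) (Ψ : traceClass e →ₗ[ℂ] traceClass e) : Prop :=
  ∀ (X : traceClass e) (x : ℕ → ℝ) (ψ : ℕ → H), 0 ≤ (X : H →L[ℂ] H) →
    SpectralExpansion (X : H →L[ℂ] H) x ψ → ∀ φ : H,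
      HasSum (fun k => x k * (⟪φ, (Ψ (ketbra e (ψ k) (ψ k)) : H →L[ℂ] H) φ⟫_ℂ).re)
        (⟪φ, (Ψ X : H →L[ℂ] H) φ⟫_ℂ).re

lemma re_inner_map_headSum (e : HilbertBasis ℕ ℂ H) (Ψ : traceClass e →ₗ[ℂ] traceClass e)
    (ψ : ℕ → H) (N : ℕ) (φ : H) :
    (⟪φ, (Ψ (headSum e ψ N) : H →L[ℂ] H) φ⟫_ℂ).re =
      ∑ k ∈ Finset.range N, (⟪φ, (Ψ (ketbra e (ψ k) (ψ k)) : H →L[ℂ] H) φ⟫_ℂ).re := by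
  rw [headSum, map_sum, Submodule.coe_sum, sum_apply, inner_sum, Complex.re_sum]

/-- Ky Fan for the image of the head projection of `ψ`, Fock optimality, and passivity of the image
of the Fock head projection give the three links of the chain. -/
lemma isHeadOptimal_of_isFockOptimal {e : HilbertBasis ℕ ℂ H}
    {Ψ : traceClass e →ₗ[ℂ] traceClass e} (hpos : IsPositivePreserving e Ψ)
    (hpp : IsPassivePreserving e Ψ) (hfo : IsFockOptimal e Ψ) : IsHeadOptimal e Ψ := by
  intro φ ψ hφ hψ M N
  -- `WeaklySubmajorizes` compares sums of at least one term; the empty sum is separate.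
  cases M with
  | zero => simp
  | succ M =>
  have hP := headSum_nonneg e ψ N
  have hZ := headSum_nonneg e e N
  have hZe := spectralExpansion_headSum e e.orthonormal N
  -- Head projections of rank `N` all have the same eigenvalues, hence the same rearrangement.
  have hZP : (headSum e e N : H →L[ℂ] H) =
      fockRearrangement e (headSum e ψ N : H →L[ℂ] H) := by
    have h := spectralExpansion_fockRearrangement e _ hP
    rw [(spectralExpansion_headSum e hψ N).eigenvalueSeq_eq hP] at h
    exact hZe.eq_of_same h
  obtain ⟨χ, hχ⟩ := exists_spectralExpansion e _ (hpos _ hP)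
  have hpass := (isPassive_iff e _ (hpos _ hZ)).1 (hpp _ hZ (hZe.isPassive hZ))
  simp only [← re_inner_map_headSum]
  calc _ ≤ _ := hχ.sum_inner_le (hpos _ hP) hφ (M + 1)
    _ ≤ _ := hfo _ _ hP hZP M
    _ = _ := (hpass.sum_inner_eq (M + 1)).symm

/-- Head optimality extends from projections to positive trace-class operators. -/
lemma IsHeadOptimal.sum_inner_le {e : HilbertBasis ℕ ℂ H}
    {Ψ : traceClass e →ₗ[ℂ] traceClass e} (h : IsHeadOptimal e Ψ) (hn : IsNormalMap e Ψ)
    {X Z : traceClass e} (hX : 0 ≤ (X : H →L[ℂ] H)) (hZ : 0 ≤ (Z : H →L[ℂ] H)) {x : ℕ → ℝ}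
    {ψ : ℕ → H} (hXx : SpectralExpansion (X : H →L[ℂ] H) x ψ)
    (hZx : SpectralExpansion (Z : H →L[ℂ] H) x e) {φ : ℕ → H} (hφ : Orthonormal ℂ φ) (M : ℕ) :
    ∑ i ∈ Finset.range M, (⟪φ i, (Ψ X : H →L[ℂ] H) (φ i)⟫_ℂ).re ≤
      ∑ i ∈ Finset.range M, (⟪e i, (Ψ Z : H →L[ℂ] H) (e i)⟫_ℂ).re := by
  have h1 := hasSum_sum (s := Finset.range M) fun i _ => hn X x ψ hX hXx (φ i)
  have h2 := hasSum_sum (s := Finset.range M) fun i _ => hn Z x e hZ hZx (e i)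
  simp only [← Finset.mul_sum] at h1 h2
  -- Head optimality is exactly the required comparison of partial sums of the weights.
  refine hasSum_mul_le_of_antitone hXx.1 (hXx.nonneg hX) (fun N => ?_) h1 h2
  rw [Finset.sum_comm, Finset.sum_comm (s := Finset.range N)]
  exact h φ ψ hφ hXx.2.1 M N

/-- For passive `X`, take `Z = X`: among orthonormal sequences, the Fock basis maximizes the
diagonal sums of the image. -/
lemma IsHeadOptimal.isPassivePreserving {e : HilbertBasis ℕ ℂ H}
    {Ψ : traceClass e →ₗ[ℂ] traceClass e} (h : IsHeadOptimal e Ψ)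
    (hpos : IsPositivePreserving e Ψ) (hn : IsNormalMap e Ψ) : IsPassivePreserving e Ψ := by
  intro X hX hXp
  have hXe := (isPassive_iff e X hX).1 hXp
  exact isPassive_of_sum_inner_le e _ (hpos X hX) fun φ hφ M =>
    h.sum_inner_le hn hX hX hXe hXe hφ M

lemma SpectralExpansion.nonneg_of_nonneg {X : H →L[ℂ] H} {x : ℕ → ℝ} {ψ : ℕ → H}
    (h : SpectralExpansion X x ψ) (hx : ∀ k, 0 ≤ x k) : 0 ≤ X := by
  refine nonneg_of_inner_nonneg fun v => ?_
  refine ((h.2.2 v).mapL (innerSL ℂ v)).nonneg fun k => ?_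
  rw [innerSL_apply_apply, inner_smul_right, mul_assoc, ← inner_conj_symm v, Complex.mul_conj,
    ← Complex.ofReal_mul]
  exact_mod_cast mul_nonneg (hx k) (Complex.normSq_nonneg _)

/-- With `φ` an eigenbasis of `Ψ X`, the left side is its eigenvalue sum; Ky Fan for `Ψ Z` bounds
the right side by eigenvalues. -/
lemma IsHeadOptimal.isFockOptimal {e : HilbertBasis ℕ ℂ H}
    {Ψ : traceClass e →ₗ[ℂ] traceClass e} (h : IsHeadOptimal e Ψ)
    (hpos : IsPositivePreserving e Ψ) (hn : IsNormalMap e Ψ) : IsFockOptimal e Ψ := by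
  intro X Z hX hZX n
  obtain ⟨ψ, hψ⟩ := exists_spectralExpansion e X hX
  have hZe := spectralExpansion_fockRearrangement e X hX
  rw [← hZX] at hZe
  have hZ := hZe.nonneg_of_nonneg (hψ.nonneg hX)
  obtain ⟨φ, hφ⟩ := exists_spectralExpansion e _ (hpos X hX)
  obtain ⟨χ, hχ⟩ := exists_spectralExpansion e _ (hpos Z hZ)
  rw [← hφ.sum_inner_eq]
  exact (h.sum_inner_le hn hX hZ hψ hZe hφ.2.1 (n + 1)).trans
    (hχ.sum_inner_le (hpos Z hZ) e.orthonormal (n + 1))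

theorem isPassivePreserving_and_isFockOptimal_iff {e : HilbertBasis ℕ ℂ H}
    {Ψ : traceClass e →ₗ[ℂ] traceClass e} (hpos : IsPositivePreserving e Ψ)
    (hn : IsNormalMap e Ψ) :
    (IsPassivePreserving e Ψ ∧ IsFockOptimal e Ψ) ↔ IsHeadOptimal e Ψ :=
  ⟨fun h => isHeadOptimal_of_isFockOptimal hpos h.1 h.2,
    fun h => ⟨h.isPassivePreserving hpos hn, h.isFockOptimal hpos hn⟩⟩

/-! ### Quantum operations and their duals -/

namespace QuantumOperation

variable {e : HilbertBasis ℕ ℂ H} (Φ : QuantumOperation e)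

lemma trace_mul_dual (Y : H →L[ℂ] H) (X : traceClass e) :
    trace e (Y * (Φ.toLinearMap X : H →L[ℂ] H)) = trace e (Φ.dual Y * (X : H →L[ℂ] H)) :=
  isHSDual_hsDual e Φ.toLinearMap Φ.continuous Y X

lemma inner_dual (Y : H →L[ℂ] H) (u v : H) :
    ⟪v, Φ.dual Y u⟫_ℂ = trace e (Y * (Φ.toLinearMap (ketbra e u v) : H →L[ℂ] H)) := by
  rw [trace_mul_dual, ketbra, trace_mul_rankOne]

/-- The source of the symmetry: under duality the input and the test vector change places. -/
lemma inner_dual_rankOne (φ ψ : H) :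
    ⟪φ, Φ.dual (InnerProductSpace.rankOne ℂ ψ ψ) φ⟫_ℂ =
      ⟪ψ, (Φ.toLinearMap (ketbra e φ φ) : H →L[ℂ] H) ψ⟫_ℂ := by
  rw [inner_dual, trace_rankOne_mul]

lemma isPositivePreserving : IsPositivePreserving e Φ.toLinearMap := by
  intro X hX
  refine nonneg_of_inner_nonneg fun v => ?_
  -- Blocks of size one suffice.
  have h := Φ.completelyPositive 1 (fun _ _ => X) (fun w => by
    simpa using ((ContinuousLinearMap.nonneg_iff_isPositive _).1 hX).inner_nonneg_right (w 0))
    (fun _ => v)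
  simpa using h

/-- Testing against `|φ⟩⟨φ|` moves the map to the bounded operator `Φ†(|φ⟩⟨φ|)`, and the trace
against `X` expands over its eigenvectors. -/
lemma isNormalMap : IsNormalMap e Φ.toLinearMap := by
  intro X x ψ hX h φ
  have h1 := (h.hasSum_trace_mul hX (Φ.dual (InnerProductSpace.rankOne ℂ φ φ))).mapL Complex.reCLM
  rw [← trace_mul_dual, trace_rankOne_mul] at h1
  refine h1.congr_fun fun k => ?_
  rw [inner_dual_rankOne, Complex.reCLM_apply, Complex.re_ofReal_mul]

variable (hmaps : ∀ X ∈ traceClass e, (Φ.dual : (H →L[ℂ] H) →ₗ[ℂ] (H →L[ℂ] H)) X ∈ traceClass e)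

/-- Expands `Tr[X Φ(|φ⟩⟨φ|)]` over the eigenvectors of `X`; positivity and normality of the dual
both follow from it. -/
lemma hasSum_inner_dual {X : traceClass e} (hX : 0 ≤ (X : H →L[ℂ] H)) {x : ℕ → ℝ} {ψ : ℕ → H}
    (h : SpectralExpansion (X : H →L[ℂ] H) x ψ) (φ : H) :
    HasSum (fun k => (x k : ℂ) * ⟪ψ k, (Φ.toLinearMap (ketbra e φ φ) : H →L[ℂ] H) (ψ k)⟫_ℂ)
      ⟪φ, Φ.dual (X : H →L[ℂ] H) φ⟫_ℂ := by
  rw [inner_dual]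
  exact h.hasSum_trace_mul' hX _

lemma isPositivePreserving_dual :
    IsPositivePreserving e ((Φ.dual : (H →L[ℂ] H) →ₗ[ℂ] (H →L[ℂ] H)).restrict hmaps) := by
  intro X hX
  obtain ⟨ψ, h⟩ := exists_spectralExpansion e X hX
  refine nonneg_of_inner_nonneg fun φ => (Φ.hasSum_inner_dual hX h φ).nonneg fun k => ?_
  refine mul_nonneg (by exact_mod_cast h.nonneg hX k) ?_
  have hP : (0 : H →L[ℂ] H) ≤ ketbra e φ φ := (ContinuousLinearMap.nonneg_iff_isPositive _).2
    (InnerProductSpace.isPositive_rankOne_self φ)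
  exact ((ContinuousLinearMap.nonneg_iff_isPositive _).1
    (Φ.isPositivePreserving _ hP)).inner_nonneg_right _

lemma isNormalMap_dual :
    IsNormalMap e ((Φ.dual : (H →L[ℂ] H) →ₗ[ℂ] (H →L[ℂ] H)).restrict hmaps) := by
  intro X x ψ hX h φ
  refine ((Φ.hasSum_inner_dual hX h φ).mapL Complex.reCLM).congr_fun fun k => ?_
  rw [Complex.reCLM_apply, Complex.re_ofReal_mul, ← inner_dual_rankOne]
  rfl

lemma isHeadOptimal_dual_iff :
    IsHeadOptimal e ((Φ.dual : (H →L[ℂ] H) →ₗ[ℂ] (H →L[ℂ] H)).restrict hmaps) ↔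
      IsHeadOptimal e Φ.toLinearMap := by
  have hk : ∀ φ ψ : H, ⟪φ, ((Φ.dual : (H →L[ℂ] H) →ₗ[ℂ] (H →L[ℂ] H)).restrict hmaps
      (ketbra e ψ ψ) : H →L[ℂ] H) φ⟫_ℂ = ⟪ψ, (Φ.toLinearMap (ketbra e φ φ) : H →L[ℂ] H) ψ⟫_ℂ :=
    Φ.inner_dual_rankOne
  simp only [IsHeadOptimal, hk]
  -- Exchanging `(φ, M)` with `(ψ, N)` is an involution, so one argument proves both directions.
  constructor <;>
  · intro h φ ψ hφ hψ M N
    rw [Finset.sum_comm, Finset.sum_comm (s := Finset.range M)]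
    exact h ψ φ hψ hφ N M

end QuantumOperation

end FockRearrangement

end

open FockRearrangement
theorem mainTheorem4 {H : Type*} [NormedAddCommGroup H] [InnerProductSpace ℂ H] [CompleteSpace H]
    (e : HilbertBasis ℕ ℂ H) (Φ : QuantumOperation e)
    (hmaps : ∀ X ∈ traceClass e, (Φ.dual : (H →L[ℂ] H) →ₗ[ℂ] (H →L[ℂ] H)) X ∈ traceClass e)
    (hcont : TraceNormContinuous e
      ((Φ.dual : (H →L[ℂ] H) →ₗ[ℂ] (H →L[ℂ] H)).restrict hmaps)) :
    (IsPassivePreserving e Φ.toLinearMap ∧ IsFockOptimal e Φ.toLinearMap) ↔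
      (IsPassivePreserving e ((Φ.dual : (H →L[ℂ] H) →ₗ[ℂ] (H →L[ℂ] H)).restrict hmaps) ∧
        IsFockOptimal e ((Φ.dual : (H →L[ℂ] H) →ₗ[ℂ] (H →L[ℂ] H)).restrict hmaps)) := by
  rw [isPassivePreserving_and_isFockOptimal_iff Φ.isPositivePreserving Φ.isNormalMap,
    isPassivePreserving_and_isFockOptimal_iff (Φ.isPositivePreserving_dual hmaps)
      (Φ.isNormalMap_dual hmaps), Φ.isHeadOptimal_dual_iff hmaps]
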